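/- Let $\alpha\in\mathbb R$ be irrational, let $S_1=\mathbb R/\mathbb Z\cong[0,1)$ carry Lebesgue measure, and write $\mathbb Z_2=\{-1,1\}$ multiplicatively, with its Haar probability measure $d\kappa$. Let $\varphi(t,s)=-1$ if $0\le s<t<1$ and $\varphi(t,s)=1$ otherwise, and consider the $\mathbb Z_2$-extension $$T_\varphi(t,s,\kappa)=(t,\,s+\alpha,\,\kappa\cdot\varphi(t,s))$$ on $S_1\times S_1\times\mathbb Z_2$. It preserves the probability measure $dt\times ds\times d\kappa$ and is, through the second coordinate, an extension of the rotation $R_\alpha:s\mapsto s+\alpha$ of $S_1$ with Lebesgue measure. The itinerary map $$(t,s,\kappa)\mapsto(x_n)_{n\ge1},\qquad x_n=\kappa\prod_{i=0}^{n-2}\varphi(t,s+i\alpha),$$ is an isomorphism (modulo null sets) of this system with the shift on $\{-1,1\}^{\mathbb N}$ equipped with the image measure $\mu$; in particular, $\mu$ is a shift-invariant probability measure. For shift-invariant probability measures $\mu$ on $K^{\mathbb N}$ and $\nu$ on $L^{\mathbb N}$, with $K,L\subset\mathbb C$ compact, let $$\mathrm{corr}(\mu,\nu)=\sup_\xi\Bigl|\int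 x_1\overline{y_1}\,d\xi-\int x_1\,d\mu\cdot\int\overline{y_1}\,d\nu\Bigr|,$$ where $\xi$ ranges over all joinings of $\mu$ and $\nu$ (measures on the product with marginals $\mu$ and $\nu$ that are invariant under the product map). Call $\mu,\nu$ uncorrelated if $\mathrm{corr}(\mu,\nu)=0$. Call two measure-preserving systems disjoint if $\int f(x)g(y)\,d\xi=\int f\,d\mu\cdot\int g\,d\nu$ for every joining $\xi$ of their invariant measures $\mu,\nu$ and all bounded measurable functions $f,g$. Then: 1. For every compact $L\subset\mathbb C$ and every ergodic shift-invariant probability measure $\nu$ on $L^{\mathbb N}$, the measures $\mu$ and $\nu$ are uncorrelated. 2. Nevertheless, $(\{-1,1\}^{\mathbb N},\mu)$ with the shift is an extension of the ergodic rotation $R_\alpha$: there is a factor map $\pi$ onto $R_\alpha$ that recovers the coordinate $s$ from the itinerary of almost every $(t,s,\kappa)$. Hence $\mu$ is not disjoint from $R_\alpha$, and there is an ergodic shift-invariant probability measure on $\{-1,1\}^{\mathbb N}$ from which $\mu$ is not disjoint. -/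

import Mathlib

open MeasureTheory
open scoped ComplexConjugate

namespace ShiftCorr

/-! ### Joinings, disjointness, factor maps -/

section Systems

variable {X Y : Type*} [MeasurableSpace X] [MeasurableSpace Y]

/-- `ξ` is a joining of the systems `(X, μ, T)` and `(Y, ν, S)`: a measure on `X × Y` with
marginals `μ` and `ν`, invariant under `T × S`. -/
structure IsJoining (T : X → X) (μ : Measure X) (S : Y → Y) (ν : Measure Y)
    (ξ : Measure (X × Y)) : Prop where
  map_fst : ξ.map Prod.fst = μ
  map_snd : ξ.map Prod.snd = ν
  invariant : MeasurePreserving (Prod.map T S) ξ ξ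

/-- Disjointness in the sense of Furstenberg, tested on all bounded measurable functions. -/
def AreDisjoint (T : X → X) (μ : Measure X) (S : Y → Y) (ν : Measure Y) : Prop :=
  ∀ ξ : Measure (X × Y), IsJoining T μ S ν ξ →
    ∀ (f : X → ℂ) (g : Y → ℂ), Measurable f → Measurable g →
      (∃ C : ℝ, ∀ x, ‖f x‖ ≤ C) → (∃ C : ℝ, ∀ y, ‖g y‖ ≤ C) →
        ∫ p, f p.1 * g p.2 ∂ξ - (∫ x, f x ∂μ) * (∫ y, g y ∂ν) = 0

/-- `π` is a factor map from `(X, μ, T)` to `(Y, ν, S)`; that is, it exhibits `(X, μ, T)` as an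
extension of `(Y, ν, S)`. -/
structure IsFactorMap (T : X → X) (μ : Measure X) (S : Y → Y) (ν : Measure Y)
    (π : X → Y) : Prop where
  measurePreserving : MeasurePreserving π μ ν
  equivariant : ∀ᵐ x ∂μ, π (T x) = S (π x)

/-- `Φ` is an isomorphism (modulo null sets) of `(X, μ, T)` with `(Y, ν, S)`. -/
def IsIsoMap (T : X → X) (μ : Measure X) (S : Y → Y) (ν : Measure Y) (Φ : X → Y) : Prop :=
  IsFactorMap T μ S ν Φ ∧
    ∃ Ψ : Y → X, IsFactorMap S ν T μ Ψ ∧ (∀ᵐ x ∂μ, Ψ (Φ x) = x) ∧ (∀ᵐ y ∂ν, Φ (Ψ y) = y)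

end Systems

/-! ### Symbolic spaces and correlation

Sequences are indexed from `0`, so that `x 0` is the first symbol of `x`. -/

/-- The shift on the sequences with symbols in `A`. -/
def shift {A : Type*} (x : ℕ → A) : ℕ → A := fun n => x (n + 1)

/-- The correlation of two shift-invariant measures on `K^ℕ` and `L^ℕ`, where `K, L ⊆ ℂ`: the
supremum, over all joinings, of
`|∫ x₁ * conj y₁ dξ - ∫ x₁ dμ * ∫ conj y₁ dν|`. It takes values in `[0, ∞]`. -/
noncomputable def corr {K L : Set ℂ} (μ : Measure (ℕ → K)) (ν : Measure (ℕ → L)) : ENNReal :=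
  ⨆ ξ ∈ {ξ : Measure ((ℕ → K) × (ℕ → L)) | IsJoining shift μ shift ν ξ},
    ‖∫ p, (p.1 0 : ℂ) * conj (p.2 0 : ℂ) ∂ξ
      - (∫ x, (x 0 : ℂ) ∂μ) * (∫ y, conj (y 0 : ℂ) ∂ν)‖ₑ

/-- Two shift-invariant measures are uncorrelated if their correlation vanishes. -/
def Uncorrelated {K L : Set ℂ} (μ : Measure (ℕ → K)) (ν : Measure (ℕ → L)) : Prop :=
  corr μ ν = 0

/-! ### The `ℤ₂`-extension

The circle is `UnitAddCircle = ℝ ⧸ ℤ` with its Lebesgue (Haar) probability measure `volume`, and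
`ℤ₂`, written multiplicatively, is `ℤˣ = {1, -1}`. -/

/-- The rotation by `α` on the circle. -/
def rotation (α : ℝ) (s : UnitAddCircle) : UnitAddCircle := s + (α : UnitAddCircle)

/-- The representative in `[0, 1)` of a point of the circle. -/
noncomputable def rep (s : UnitAddCircle) : ℝ := (AddCircle.equivIco (1 : ℝ) 0 s : ℝ)

/-- The cocycle, `-1` on the triangle `0 ≤ s < t < 1` and `1` elsewhere. -/
noncomputable def cocycle (t s : UnitAddCircle) : ℤˣ := if rep s < rep t then -1 else 1

/-- The skew product `(t, s, κ) ↦ (t, s + α, κ * φ(t, s))`. -/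
noncomputable def skew (α : ℝ) (p : UnitAddCircle × UnitAddCircle × ℤˣ) :
    UnitAddCircle × UnitAddCircle × ℤˣ :=
  (p.1, rotation α p.2.1, p.2.2 * cocycle p.1 p.2.1)

/-- The Haar probability measure on `ℤ₂`: each point has mass `1 / 2`. -/
noncomputable def haarZ2 : Measure ℤˣ := (2⁻¹ : ENNReal) • Measure.count

/-- The measure `dt × ds × dκ`. -/
noncomputable def skewMeasure : Measure (UnitAddCircle × UnitAddCircle × ℤˣ) :=
  (volume : Measure UnitAddCircle).prod ((volume : Measure UnitAddCircle).prod haarZ2)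

/-- The alphabet `{-1, 1}`. -/
def signs : Set ℂ := {-1, 1}

/-- An element of `ℤ₂` as a symbol of the alphabet `{-1, 1}`. -/
def toSign (u : ℤˣ) : signs :=
  ⟨((u : ℤ) : ℂ), by rcases Int.units_eq_one_or u with rfl | rfl <;> simp [signs]⟩

/-- The `ℤ₂`-itinerary of `(t, s, κ)`: its symbol number `n` (counted from `0`) is
`κ * ∏ i < n, φ(t, s + i α)`. -/
noncomputable def itinerary (α : ℝ) (p : UnitAddCircle × UnitAddCircle × ℤˣ) : ℕ → signs :=
  fun n => toSign
    (p.2.2 * ∏ i ∈ Finset.range n, cocycle p.1 (p.2.1 + ((i * α : ℝ) : UnitAddCircle)))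

/-- The symbolic representation on `{-1, 1}^ℕ` of the measure `dt × ds × dκ`. -/
noncomputable def symbolicMeasure (α : ℝ) : Measure (ℕ → signs) :=
  skewMeasure.map (itinerary α)

end ShiftCorr

/-!
Off the null set `t = 0`, the itinerary of `(t, s, κ)` determines the point: its successive
quotients tell when the orbit of `s` under the irrational rotation visits `[0, t)`, and density of
the orbits recovers `t` and `s` from these visits (`eq_of_cocycle_orbit_eq`). The Lusin–Souslin
theorem makes the inverse measurable, which gives the isomorphism and the factor map onto the
rotation. The graph of a factor map onto a system with a unimodular function of mean zero is a
joining that witnesses non-disjointness (`IsFactorMap.not_areDisjoint`); for the symbolic ergodic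
system, the rotation is coded by the partition into two half circles.

Vanishing correlation means that in every joining of the skew product with an ergodic system
`(Y, ν, S)` the conditional mean of `κ` given `y ∈ Y` vanishes. Let `K(y, t, s)` be the conditional
mean of `κ` given `(y, t, s)`, and form the relatively independent self-joining over `Y` of the law
of `(y, t, s)`, with points `(y, t, s, t', s')`. The transformation `S` need not be invertible, but
the self-joining is still invariant, since conditional means given `y` are equivariant
(`condMean_translate`): the conditional mean of `f(x + v)` has at least the `L²` norm of that of
`f`, and these norms return to their initial value along the times at which the translation is
close to the identity. Ergodicity of `S` makes the invariant coordinates `t` and `t'` independent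
(`selfJoining_prod_of_invariant`). It remains to see that the conditional mean `F` of
`K(y, t, s) * K(y, t', s')` given `(t, s, t', s')` vanishes, as its integral is that of the squared
conditional mean of `κ` given `y`. Now `F` is multiplied by `φ(t, s) * φ(t', s')` under the
diagonal rotation, so that `ae_eq_zero_of_equivariant` applies.

The argument for `F = 0` uses the denominators `q` of approximations `p / q` of `α` with
`|q * α - p| < 1 / q`. Write `φ_q(t, s)` for the product of the cocycle along `q` steps and `m_q(t)`
for its mean over `s`. As `q` steps of the rotation are close to the identity, `F` is nearly
multiplied by `1`, so `φ_q(t, s) ≈ φ_q(t', s')` where `F ≠ 0`. The measure with density `|F|` is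
invariant under the diagonal rotation, hence under the diagonal translations by all of the circle,
and averaging over these gives `m_q(t) ≈ m_q(t')` where `F ≠ 0`. By independence of `t` and
`t'` this holds, if `F` does not vanish, for a set of pairs `(t, t')` of positive measure. But
`|m_q|` is nearly invariant under the rotation, because `φ_q(t + α, s)` differs from `φ_q(t, s)`,
up to signs that do not depend on `s`, by a telescoping product. By ergodicity `|m_q|` would be
asymptotically constant almost everywhere along the sequence. This is false
(`integral_abs_cocycleMean_sub_ge`): `|m_q|` takes the values `1` and `0`, is Lipschitz with
constant `2 * q`, and nearly invariant for `q / 16` steps of the rotation, whose points are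
`1 / (2 * q)`-separated; so it is near each of these values on sets of measure at
least `1 / 128`.
-/

namespace ShiftCorr

open Filter Topology ProbabilityTheory

/-! ### The skew product preserves its measure -/

theorem measurable_rep : Measurable rep :=
  measurable_subtype_coe.comp (AddCircle.measurableEquivIco (1 : ℝ) 0).measurable

theorem rep_nonneg (s : UnitAddCircle) : 0 ≤ rep s := (AddCircle.equivIco (1 : ℝ) 0 s).2.1

theorem rep_lt_one (s : UnitAddCircle) : rep s < 1 :=
  (AddCircle.equivIco (1 : ℝ) 0 s).2.2.trans_eq (zero_add 1)

theorem coe_rep (s : UnitAddCircle) : ((rep s : ℝ) : UnitAddCircle) = s :=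
  (AddCircle.equivIco (1 : ℝ) 0).symm_apply_apply s

theorem rep_coe (x : ℝ) : rep (x : UnitAddCircle) = Int.fract x := by
  simp [rep]

theorem measurable_cocycle :
    Measurable (fun q : UnitAddCircle × UnitAddCircle => cocycle q.1 q.2) :=
  Measurable.ite (measurableSet_lt (measurable_rep.comp measurable_snd)
    (measurable_rep.comp measurable_fst)) measurable_const measurable_const

instance : DiscreteMeasurableSpace ℤˣ where
  forall_measurableSet s := by
    refine ⟨Units.val '' s, .of_discrete, ?_⟩
    exact Set.preimage_image_eq s Units.val_injective

theorem abs_units_coe (u : ℤˣ) : |((u : ℤ) : ℝ)| = 1 := by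
  rcases Int.units_eq_one_or u with h | h <;> rw [h] <;> norm_num

theorem measurable_units_coe : Measurable fun u : ℤˣ => ((u : ℤ) : ℝ) :=
  measurable_of_countable _

instance : IsProbabilityMeasure (volume : Measure UnitAddCircle) := ⟨UnitAddCircle.measure_univ⟩

theorem measurable_skew (α : ℝ) : Measurable (skew α) := by
  unfold skew rotation
  have h : Measurable (fun p : UnitAddCircle × UnitAddCircle × ℤˣ => cocycle p.1 p.2.1) :=
    measurable_cocycle.comp
      (f := fun p : UnitAddCircle × UnitAddCircle × ℤˣ => (p.1, p.2.1)) (by fun_prop)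
  fun_prop

instance : IsProbabilityMeasure haarZ2 := by
  refine ⟨?_⟩
  rw [haarZ2, Measure.smul_apply, Measure.count_univ]
  simp
  exact ENNReal.inv_mul_cancel (by simp) (by simp)

instance : IsProbabilityMeasure skewMeasure := by unfold skewMeasure; infer_instance

theorem haarZ2_mul (u : ℤˣ) : MeasurePreserving (fun κ => κ * u) haarZ2 haarZ2 := by
  unfold haarZ2
  refine MeasurePreserving.smul_measure ?_ _
  exact ⟨by fun_prop, MeasureTheory.map_mul_right_eq_self _ u⟩

theorem measurePreserving_rotation (α : ℝ) : MeasurePreserving (rotation α) volume volume :=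
  measurePreserving_add_right _ _

theorem measurePreserving_skew (α : ℝ) : MeasurePreserving (skew α) skewMeasure skewMeasure := by
  unfold skewMeasure
  refine MeasurePreserving.skew_product (f := id)
    (g := fun (t : UnitAddCircle) (q : UnitAddCircle × ℤˣ) =>
      (rotation α q.1, q.2 * cocycle t q.1)) (MeasurePreserving.id _) ?_ ?_
  · exact (measurable_skew α).snd
  · refine ae_of_all _ fun t => MeasurePreserving.map_eq ?_
    refine MeasurePreserving.skew_product (f := rotation α)
      (g := fun (s : UnitAddCircle) (κ : ℤˣ) => κ * cocycle t s)
      (measurePreserving_rotation α) ?_ ?_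
    · exact measurable_snd.mul (measurable_cocycle.comp
        (f := fun q : UnitAddCircle × ℤˣ => (t, q.1)) (by fun_prop))
    · exact ae_of_all _ fun s => (haarZ2_mul _).map_eq

theorem measurable_toSign : Measurable toSign := measurable_of_countable _

theorem measurable_itinerary (α : ℝ) : Measurable (itinerary α) := by
  refine measurable_pi_lambda _ fun n => measurable_toSign.comp ?_
  refine measurable_snd.snd.mul (Finset.measurable_fun_prod _ fun i _ => ?_)
  exact measurable_cocycle.comp (f := fun p : UnitAddCircle × UnitAddCircle × ℤˣ =>
    (p.1, p.2.1 + ((i * α : ℝ) : UnitAddCircle))) (by fun_prop)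

theorem itinerary_skew (α : ℝ) (p : UnitAddCircle × UnitAddCircle × ℤˣ) :
    itinerary α (skew α p) = shift (itinerary α p) := by
  funext n
  simp only [itinerary, skew, shift, rotation]
  congr 1
  rw [Finset.prod_range_succ', mul_assoc, mul_comm (cocycle _ _)]
  congr 2
  · refine Finset.prod_congr rfl fun i _ => ?_
    congr 1
    rw [add_assoc, ← AddCircle.coe_add]
    congr 2
    push_cast; ring
  · simp

theorem measurable_shift {A : Type*} [MeasurableSpace A] : Measurable (shift (A := A)) :=
  measurable_pi_lambda _ fun n => measurable_pi_apply (n + 1)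

theorem toSign_injective : Function.Injective toSign := by
  intro u v h
  have : ((u : ℤ) : ℂ) = ((v : ℤ) : ℂ) := congrArg Subtype.val h
  exact Units.ext (by exact_mod_cast this)

/-! ### Rotation orbits determine the parameters -/

theorem coe_nsmul_mul (α : ℝ) (n : ℕ) :
    ((n * α : ℝ) : UnitAddCircle) = n • (α : UnitAddCircle) := by
  rw [← nsmul_eq_mul, AddCircle.coe_nsmul]

theorem denseRange_nsmul {α : ℝ} (hα : Irrational α) :
    DenseRange (fun n : ℕ => n • (α : UnitAddCircle)) := by
  rw [← denseRange_zsmul_iff_nsmul]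
  exact AddCircle.denseRange_zsmul_coe_iff.2 (by simpa using hα)

theorem ergodic_rotation {α : ℝ} (hα : Irrational α) : Ergodic (rotation α) volume :=
  AddCircle.ergodic_add_right.2
    (AddCircle.denseRange_zsmul_iff.1 (AddCircle.denseRange_zsmul_coe_iff.2 (by simpa using hα)))

/-- Every orbit of an irrational rotation visits every arc `(a, b)`. -/
theorem exists_rep_orbit_mem {α : ℝ} (hα : Irrational α) (s : UnitAddCircle) {a b : ℝ}
    (ha : 0 ≤ a) (hab : a < b) (hb : b ≤ 1) :
    ∃ i : ℕ, a < rep (s + ((i * α : ℝ) : UnitAddCircle)) ∧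
      rep (s + ((i * α : ℝ) : UnitAddCircle)) < b := by
  have hd : DenseRange fun n : ℕ => s + n • (α : UnitAddCircle) :=
    (Homeomorph.addLeft s).surjective.denseRange.comp (denseRange_nsmul hα)
      (Homeomorph.addLeft s).continuous
  have ho : IsOpen ((fun x : ℝ => (x : UnitAddCircle)) '' Set.Ioo a b) :=
    QuotientAddGroup.isOpenMap_coe _ isOpen_Ioo
  obtain ⟨i, x, hx, hi⟩ := hd.exists_mem_open ho ((Set.nonempty_Ioo.2 hab).image _)
  refine ⟨i, ?_⟩
  have : s + ((i * α : ℝ) : UnitAddCircle) = (x : UnitAddCircle) := by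
    rw [show (x : UnitAddCircle) = _ from hi, coe_nsmul_mul]
  rw [this, rep_coe, Int.fract_eq_self.2 ⟨by linarith [hx.1], by linarith [hx.2]⟩]
  exact hx

theorem rep_add (u d : UnitAddCircle) : rep (u + d) = Int.fract (rep u + rep d) := by
  rw [← rep_coe, AddCircle.coe_add, coe_rep, coe_rep]

theorem rep_add_of_lt {u d : UnitAddCircle} (h : rep u + rep d < 1) :
    rep (u + d) = rep u + rep d := by
  rw [rep_add, Int.fract_eq_self.2 ⟨add_nonneg (rep_nonneg _) (rep_nonneg _), h⟩]

theorem rep_add_of_ge {u d : UnitAddCircle} (h : 1 ≤ rep u + rep d) :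
    rep (u + d) = rep u + rep d - 1 := by
  rw [rep_add, ← Int.fract_sub_one, Int.fract_eq_self]
  constructor <;> linarith [rep_lt_one u, rep_lt_one d]

theorem cocycle_eq_iff {t s t' s' : UnitAddCircle} :
    cocycle t s = cocycle t' s' ↔ (rep s < rep t ↔ rep s' < rep t') := by
  unfold cocycle
  split_ifs with h h' h' <;> simp [h, h']

/-- The sequence of the visits of an orbit to the arc `[0, t)` determines both the arc and the
initial point of the orbit. -/
theorem eq_of_cocycle_orbit_eq {α : ℝ} (hα : Irrational α) {t s t' s' : UnitAddCircle}
    (ht : rep t ≠ 0)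
    (h : ∀ i : ℕ, cocycle t (s + ((i * α : ℝ) : UnitAddCircle)) =
      cocycle t' (s' + ((i * α : ℝ) : UnitAddCircle))) : t = t' ∧ s = s' := by
  have ht0 : 0 < rep t := (rep_nonneg t).lt_of_ne' ht
  obtain ⟨d, rfl⟩ : ∃ d, s' = s + d := ⟨s' - s, by abel⟩
  replace h : ∀ i : ℕ, rep (s + ((i * α : ℝ) : UnitAddCircle)) < rep t ↔
      rep (s + ((i * α : ℝ) : UnitAddCircle) + d) < rep t' := fun i => by
    rw [add_right_comm]; exact cocycle_eq_iff.1 (h i)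
  have hd : rep d = 0 := by
    by_contra hd
    have hd0 : 0 < rep d := (rep_nonneg d).lt_of_ne' hd
    -- points of the orbit slightly to the right of `0` show that `d` lies in `[0, t')`
    obtain ⟨i, hi0, hi⟩ := exists_rep_orbit_mem hα s le_rfl
      (lt_min ht0 (sub_pos.2 (rep_lt_one d))) ((min_le_left _ _).trans (rep_lt_one t).le)
    rw [lt_min_iff] at hi
    have h1 := (h i).1 hi.1
    rw [rep_add_of_lt (by linarith)] at h1
    -- and points of the orbit slightly to the left of `0` show that it does not
    obtain ⟨j, hj0, hj⟩ := exists_rep_orbit_mem hα s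
      (le_max_of_le_left ht0.le) (max_lt (rep_lt_one t) (sub_lt_self 1 hd0)) le_rfl
    rw [max_lt_iff] at hj0
    have h2 := (h j).2 (by rw [rep_add_of_ge (by linarith)]; linarith)
    linarith
  have hd' : d = 0 := by rw [← coe_rep d, hd]; simp
  subst hd'
  simp only [add_zero, and_true] at h ⊢
  rw [← coe_rep t, ← coe_rep t']
  congr 1
  rcases lt_trichotomy (rep t) (rep t') with hlt | heq | hlt
  · obtain ⟨i, h1, h2⟩ := exists_rep_orbit_mem hα s (rep_nonneg t) hlt (rep_lt_one t').le
    exact absurd ((h i).2 h2) h1.le.not_gt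
  · exact heq
  · obtain ⟨i, h1, h2⟩ := exists_rep_orbit_mem hα s (rep_nonneg t') hlt (rep_lt_one t).le
    exact absurd ((h i).1 h2) h1.le.not_gt

/-- The itineraries with `t = 0`, where the cocycle is trivial, do not determine `s`. -/
theorem injOn_itinerary {α : ℝ} (hα : Irrational α) :
    Set.InjOn (itinerary α) {p | rep p.1 ≠ 0} := by
  rintro ⟨t, s, κ⟩ ht ⟨t', s', κ'⟩ - h
  have h' : ∀ n, κ * ∏ i ∈ Finset.range n, cocycle t (s + ((i * α : ℝ) : UnitAddCircle)) =
      κ' * ∏ i ∈ Finset.range n, cocycle t' (s' + ((i * α : ℝ) : UnitAddCircle)) :=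
    fun n => toSign_injective (congrFun h n)
  have hκ : κ = κ' := by simpa using h' 0
  subst hκ
  obtain ⟨h1, h2⟩ := eq_of_cocycle_orbit_eq (t' := t') (s := s) (s' := s') hα ht fun i => by
    have h0 := mul_left_cancel (h' i)
    have h1 := mul_left_cancel (h' (i + 1))
    rw [Finset.prod_range_succ, Finset.prod_range_succ, h0] at h1
    exact mul_left_cancel h1
  exact Prod.ext h1 (Prod.ext h2 rfl)

theorem ae_rep_ne_zero : ∀ᵐ p ∂skewMeasure, rep p.1 ≠ 0 := by
  have h : ∀ᵐ t : UnitAddCircle, rep t ≠ 0 := by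
    rw [ae_iff]
    refine measure_mono_null (t := {0}) (fun t ht => ?_) ?_
    · rw [Set.mem_ofPred_eq, not_not] at ht
      rw [Set.mem_singleton_iff, ← coe_rep t, ht]
      simp
    · rw [← Metric.closedBall_zero, AddCircle.volume_closedBall]
      simp
  exact Measure.quasiMeasurePreserving_fst.ae h

/-! ### The symbolic representation -/

theorem measurePreserving_itinerary (α : ℝ) :
    MeasurePreserving (itinerary α) skewMeasure (symbolicMeasure α) :=
  ⟨measurable_itinerary α, rfl⟩

instance (α : ℝ) : IsProbabilityMeasure (symbolicMeasure α) :=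
  Measure.isProbabilityMeasure_map (measurable_itinerary α).aemeasurable

theorem measurePreserving_shift (α : ℝ) :
    MeasurePreserving (shift (A := signs)) (symbolicMeasure α) (symbolicMeasure α) := by
  refine ⟨measurable_shift, ?_⟩
  have : shift ∘ itinerary α = itinerary α ∘ skew α := funext fun p => (itinerary_skew α p).symm
  rw [symbolicMeasure, Measure.map_map measurable_shift (measurable_itinerary α), this,
    ← Measure.map_map (measurable_itinerary α) (measurable_skew α),
    (measurePreserving_skew α).map_eq]

/-- The itinerary map is injective off a null set, so it has a measurable inverse there by the
Lusin–Souslin theorem. -/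
theorem exists_measurable_leftInverse_itinerary {α : ℝ} (hα : Irrational α) :
    ∃ Ψ : (ℕ → signs) → UnitAddCircle × UnitAddCircle × ℤˣ, Measurable Ψ ∧
      ∀ᵐ p ∂skewMeasure, Ψ (itinerary α p) = p := by
  set X₀ : Set (UnitAddCircle × UnitAddCircle × ℤˣ) := {p | rep p.1 ≠ 0} with hX
  have hm : MeasurableSet X₀ :=
    ((measurable_rep.comp measurable_fst) (measurableSet_singleton 0)).compl
  have := hm.standardBorel
  have he : MeasurableEmbedding (fun p : X₀ => itinerary α p) :=
    ((measurable_itinerary α).comp measurable_subtype_coe).measurableEmbedding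
      (Set.injOn_iff_injective.1 (injOn_itinerary hα))
  obtain ⟨Ψ, hΨ, h⟩ := he.exists_measurable_extend measurable_subtype_coe
    (fun _ => ⟨(0, 0, 1)⟩)
  exact ⟨Ψ, hΨ, ae_rep_ne_zero.mono fun p hp => congrFun h ⟨p, hp⟩⟩

theorem isFactorMap_leftInverse {α : ℝ} {Ψ : (ℕ → signs) → UnitAddCircle × UnitAddCircle × ℤˣ}
    (hm : Measurable Ψ) (h : ∀ᵐ p ∂skewMeasure, Ψ (itinerary α p) = p) :
    IsFactorMap shift (symbolicMeasure α) (skew α) skewMeasure Ψ where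
  measurePreserving := by
    refine ⟨hm, ?_⟩
    rw [symbolicMeasure, Measure.map_map hm (measurable_itinerary α)]
    exact (Measure.map_congr h).trans Measure.map_id
  equivariant := by
    refine (ae_map_iff (measurable_itinerary α).aemeasurable
      (measurableSet_eq_fun (hm.comp measurable_shift) ((measurable_skew α).comp hm))).2 ?_
    filter_upwards [h, (measurePreserving_skew α).quasiMeasurePreserving.ae h] with p h1 h2
    simp only [Function.comp, ← itinerary_skew, h2, h1]

theorem ae_itinerary_leftInverse {α : ℝ} {Ψ : (ℕ → signs) → UnitAddCircle × UnitAddCircle × ℤˣ}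
    (hm : Measurable Ψ) (h : ∀ᵐ p ∂skewMeasure, Ψ (itinerary α p) = p) :
    ∀ᵐ y ∂symbolicMeasure α, itinerary α (Ψ y) = y := by
  refine (ae_map_iff (measurable_itinerary α).aemeasurable
    (measurableSet_eq_fun ((measurable_itinerary α).comp hm) measurable_id)).2 ?_
  filter_upwards [h] with p h1
  simp only [Function.comp, h1, id]

theorem isFactorMap_snd_fst (α : ℝ) : IsFactorMap (skew α) skewMeasure (rotation α) volume
    (fun p => p.2.1) where
  measurePreserving := measurePreserving_fst.comp measurePreserving_snd
  equivariant := ae_of_all _ fun _ => rfl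

theorem isFactorMap_itinerary (α : ℝ) :
    IsFactorMap (skew α) skewMeasure shift (symbolicMeasure α) (itinerary α) :=
  ⟨measurePreserving_itinerary α, ae_of_all _ (itinerary_skew α)⟩

/-! ### Factor maps and disjointness -/

theorem IsFactorMap.comp {X Y Z : Type*} [MeasurableSpace X] [MeasurableSpace Y]
    [MeasurableSpace Z] {T : X → X} {μ : Measure X} {S : Y → Y} {ν : Measure Y} {R : Z → Z}
    {ρ : Measure Z} {π : X → Y} {σ : Y → Z} (hσ : IsFactorMap S ν R ρ σ)
    (hπ : IsFactorMap T μ S ν π) : IsFactorMap T μ R ρ (σ ∘ π) where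
  measurePreserving := hσ.measurePreserving.comp hπ.measurePreserving
  equivariant := by
    filter_upwards [hπ.equivariant,
      hπ.measurePreserving.quasiMeasurePreserving.ae hσ.equivariant] with x h1 h2
    simp only [Function.comp, h1, h2]

/-- The graph of a factor map onto a system with a mean zero unimodular function is a joining
which is not the product. -/
theorem IsFactorMap.not_areDisjoint {X Y : Type*} [MeasurableSpace X] [MeasurableSpace Y]
    {T : X → X} {μ : Measure X} {S : Y → Y} {ν : Measure Y} {π : X → Y} [IsProbabilityMeasure μ]
    (hπ : IsFactorMap T μ S ν π) (hT : MeasurePreserving T μ μ) (hS : Measurable S) {g : Y → ℂ}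
    (hg : Measurable g) (hg1 : ∀ y, ‖g y‖ = 1) (hg0 : ∫ y, g y ∂ν = 0) :
    ¬ AreDisjoint T μ S ν := by
  intro h
  have hπm := hπ.measurePreserving.measurable
  have hgr : Measurable fun x => (x, π x) := measurable_id.prodMk hπm
  have hJ : IsJoining T μ S ν (μ.map fun x => (x, π x)) := by
    refine ⟨?_, ?_, hT.measurable.prodMap hS, ?_⟩
    · rw [Measure.map_map measurable_fst hgr]; exact Measure.map_id
    · rw [Measure.map_map measurable_snd hgr]; exact hπ.measurePreserving.map_eq
    · rw [Measure.map_map (hT.measurable.prodMap hS) hgr]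
      conv_rhs => rw [← hT.map_eq, Measure.map_map hgr hT.measurable]
      refine Measure.map_congr ?_
      filter_upwards [hπ.equivariant] with x hx
      simp [hx]
  have hf : Measurable fun x => conj (g (π x)) :=
    Complex.continuous_conj.measurable.comp (hg.comp hπm)
  have := h _ hJ (fun x => conj (g (π x))) g hf hg
    ⟨1, fun x => by simp [hg1]⟩ ⟨1, fun y => (hg1 y).le⟩
  rw [hg0, mul_zero, sub_zero, integral_map (f := fun p : X × Y => conj (g (π p.1)) * g p.2)
    hgr.aemeasurable
    ((hf.comp measurable_fst).mul (hg.comp measurable_snd)).aestronglyMeasurable] at this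
  simp [Complex.conj_mul', hg1] at this

/-! ### A coding of the rotation with two symbols -/

/-- The half turn exchanges the two half circles. -/
theorem cocycle_half_add_half (s : UnitAddCircle) :
    cocycle ((1 / 2 : ℝ) : UnitAddCircle) (s + ((1 / 2 : ℝ) : UnitAddCircle)) =
      -cocycle ((1 / 2 : ℝ) : UnitAddCircle) s := by
  have hr : rep ((1 / 2 : ℝ) : UnitAddCircle) = 1 / 2 := by
    rw [rep_coe, Int.fract_eq_self.2]; norm_num
  unfold cocycle
  by_cases h : rep s < 1 / 2
  · rw [rep_add_of_lt (by rw [hr]; linarith), hr, if_pos h, if_neg (by linarith [rep_nonneg s])]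
    simp
  · rw [rep_add_of_ge (by rw [hr]; linarith), hr, if_neg h, if_pos (by linarith [rep_lt_one s])]

/-- The partition of the circle into two half circles, as a function: `-1` on `[0, 1/2)` and `1`
elsewhere. -/
noncomputable def halfSign (s : UnitAddCircle) : signs :=
  toSign (cocycle ((1 / 2 : ℝ) : UnitAddCircle) s)

theorem measurable_halfSign : Measurable halfSign :=
  measurable_toSign.comp (measurable_cocycle.comp measurable_prodMk_left)

theorem integral_halfSign : ∫ s, (halfSign s : ℂ) = 0 := by
  have h := integral_add_right_eq_self (μ := (volume : Measure UnitAddCircle))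
    (fun s => (halfSign s : ℂ)) ((1 / 2 : ℝ) : UnitAddCircle)
  simp only [halfSign, toSign, cocycle_half_add_half, Units.val_neg, Int.cast_neg, integral_neg]
    at h
  exact self_eq_neg.1 h.symm

theorem norm_signs (u : signs) : ‖(u : ℂ)‖ = 1 := by
  rcases u.2 with h | h
  · rw [h]; simp
  · rw [Set.mem_singleton_iff.1 h]; simp

/-- The coding of the rotation by the partition of the circle into two half circles. -/
noncomputable def halfCoding (α : ℝ) (s : UnitAddCircle) : ℕ → signs :=
  fun n => halfSign (s + ((n * α : ℝ) : UnitAddCircle))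

theorem measurable_halfCoding (α : ℝ) : Measurable (halfCoding α) :=
  measurable_pi_lambda _ fun _ => measurable_halfSign.comp (measurable_add_const _)

theorem halfCoding_rotation (α : ℝ) (s : UnitAddCircle) :
    halfCoding α (rotation α s) = shift (halfCoding α s) := by
  funext n
  simp only [halfCoding, rotation, shift]
  congr 1
  rw [add_assoc, ← AddCircle.coe_add]
  congr 2
  push_cast; ring

theorem isFactorMap_halfCoding (α : ℝ) : IsFactorMap (rotation α) volume shift
    ((volume : Measure UnitAddCircle).map (halfCoding α)) (halfCoding α) :=
  ⟨⟨measurable_halfCoding α, rfl⟩, ae_of_all _ (halfCoding_rotation α)⟩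

theorem ergodic_map_halfCoding {α : ℝ} (hα : Irrational α) :
    Ergodic (shift (A := signs)) ((volume : Measure UnitAddCircle).map (halfCoding α)) :=
  (isFactorMap_halfCoding α).measurePreserving.ergodic_of_ergodic_semiconj
    (ergodic_rotation hα) measurable_shift (halfCoding_rotation α)

theorem measurable_zeroth_symbol {L : Set ℂ} : Measurable fun y : ℕ → L => (y 0 : ℂ) :=
  measurable_subtype_coe.comp (measurable_pi_apply 0)

theorem integral_map_halfCoding (α : ℝ) :
    ∫ y, (y 0 : ℂ) ∂(volume : Measure UnitAddCircle).map (halfCoding α) = 0 := by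
  rw [integral_map (measurable_halfCoding α).aemeasurable
    measurable_zeroth_symbol.aestronglyMeasurable]
  simpa [halfCoding] using integral_halfSign

/-! ### Square waves and the means of the cocycle products -/

/-- The square wave of period `2`, equal to `1` on `[0, 1)` and to `-1` on `[1, 2)`. -/
noncomputable def wave (x : ℝ) : ℝ := (-1 : ℝ) ^ ⌊x⌋

theorem wave_mul_self (x : ℝ) : wave x * wave x = 1 := by
  rw [wave, ← mul_zpow]; simp

theorem abs_wave (x : ℝ) : |wave x| = 1 := by
  rw [wave, abs_zpow]; simp

theorem wave_add_int (x : ℝ) (m : ℤ) : wave (x + m) = (-1 : ℝ) ^ m * wave x := by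
  rw [wave, Int.floor_add_intCast, zpow_add₀ (by norm_num), mul_comm, wave]

theorem measurable_wave : Measurable wave :=
  (measurable_of_countable (fun m : ℤ => (-1 : ℝ) ^ m)).comp Int.measurable_floor

theorem integral_fract_add (a : ℝ) : ∫ x in (0 : ℝ)..1, Int.fract (x + a) =
    ∫ x in (0 : ℝ)..1, Int.fract x := by
  have hp : Function.Periodic (Int.fract : ℝ → ℝ) 1 := Int.fract_periodic ℝ
  have := hp.intervalIntegral_add_eq a 0
  rw [intervalIntegral.integral_comp_add_right (fun x => Int.fract x)]
  simpa [add_comm] using this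

theorem intervalIntegrable_fract_add (a : ℝ) :
    IntervalIntegrable (fun x => Int.fract (x + a)) volume 0 1 := by
  rw [intervalIntegrable_iff]
  refine Measure.integrableOn_of_bounded (M := 1) (by simp)
    (measurable_fract.comp (measurable_add_const a)).aestronglyMeasurable (ae_of_all _ fun x => ?_)
  rw [Real.norm_eq_abs, abs_of_nonneg (Int.fract_nonneg _)]
  exact (Int.fract_lt_one _).le

theorem floor_add_eq_sub_fract (x a : ℝ) : (⌊x + a⌋ : ℝ) = (x + a) - Int.fract (x + a) := by
  rw [← Int.self_sub_floor]; ring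

theorem intervalIntegrable_floor_add (a : ℝ) :
    IntervalIntegrable (fun x => (⌊x + a⌋ : ℝ)) volume 0 1 := by
  simp only [floor_add_eq_sub_fract]
  exact (by fun_prop : Continuous fun x => x + a).intervalIntegrable _ _ |>.sub
    (intervalIntegrable_fract_add a)

theorem integral_floor_sub_floor (a b : ℝ) :
    ∫ x in (0 : ℝ)..1, ((⌊x + b⌋ : ℝ) - ⌊x + a⌋) = b - a := by
  have hc : ∀ c : ℝ, IntervalIntegrable (fun x => x + c) volume 0 1 := fun c =>
    (by fun_prop : Continuous fun x => x + c).intervalIntegrable _ _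
  rw [intervalIntegral.integral_sub (intervalIntegrable_floor_add b)
    (intervalIntegrable_floor_add a)]
  simp only [floor_add_eq_sub_fract]
  rw [intervalIntegral.integral_sub (hc _) (intervalIntegrable_fract_add _),
    intervalIntegral.integral_sub (hc _) (intervalIntegrable_fract_add _),
    integral_fract_add, integral_fract_add,
    intervalIntegral.integral_add (by simp) (by simp),
    intervalIntegral.integral_add (by simp) (by simp)]
  simp

theorem abs_wave_sub_wave_le (u v : ℝ) : |wave u - wave v| ≤ 2 * |(⌊u⌋ : ℝ) - ⌊v⌋| := by
  by_cases h : ⌊u⌋ = ⌊v⌋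
  · simp [wave, h]
  · have h1 : (1 : ℝ) ≤ |(⌊u⌋ : ℝ) - ⌊v⌋| := by
      exact_mod_cast Int.one_le_abs (sub_ne_zero.2 h)
    have h2 := abs_sub (wave u) (wave v)
    rw [abs_wave, abs_wave] at h2
    linarith

theorem intervalIntegrable_of_bounded {f : ℝ → ℝ} (hf : Measurable f) {C : ℝ}
    (hC : ∀ x, |f x| ≤ C) (a b : ℝ) : IntervalIntegrable f volume a b := by
  rw [intervalIntegrable_iff]
  exact Measure.integrableOn_of_bounded (M := C) (by simp) hf.aestronglyMeasurable
    (ae_of_all _ hC)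

/-- Translation is Lipschitz for the square wave in mean. -/
theorem integral_abs_wave_sub_wave_le (a b : ℝ) :
    ∫ x in (0 : ℝ)..1, |wave (x + a) - wave (x + b)| ≤ 2 * |a - b| := by
  wlog hab : a ≤ b generalizing a b
  · simpa only [abs_sub_comm] using this b a (le_of_not_ge hab)
  have hw : ∀ c, Measurable fun x => wave (x + c) := fun c =>
    measurable_wave.comp (measurable_add_const c)
  calc ∫ x in (0 : ℝ)..1, |wave (x + a) - wave (x + b)|
      ≤ ∫ x in (0 : ℝ)..1, 2 * ((⌊x + b⌋ : ℝ) - ⌊x + a⌋) := by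
        refine intervalIntegral.integral_mono_on zero_le_one
          (intervalIntegrable_of_bounded (C := 2) ((hw a).sub (hw b)).abs (fun x => ?_) _ _)
          (((intervalIntegrable_floor_add b).sub (intervalIntegrable_floor_add a)).const_mul 2)
          fun x _ => ?_
        · have := abs_sub (wave (x + a)) (wave (x + b))
          rw [abs_wave, abs_wave] at this
          rw [abs_abs]; exact this.trans (by norm_num)
        · refine (abs_wave_sub_wave_le _ _).trans_eq ?_
          rw [abs_sub_comm, abs_of_nonneg]
          have : ⌊x + a⌋ ≤ ⌊x + b⌋ := Int.floor_mono (by linarith)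
          exact sub_nonneg.2 (by exact_mod_cast this)
    _ = 2 * |a - b| := by
        rw [intervalIntegral.integral_const_mul, integral_floor_sub_floor, abs_sub_comm,
          abs_of_nonneg (sub_nonneg.2 hab)]

theorem abs_prod_sub_prod_le {ι : Type*} (s : Finset ι) {f g : ι → ℝ} (hf : ∀ i, |f i| ≤ 1)
    (hg : ∀ i, |g i| ≤ 1) : |∏ i ∈ s, f i - ∏ i ∈ s, g i| ≤ ∑ i ∈ s, |f i - g i| := by
  classical
  induction s using Finset.induction_on with
  | empty => simp
  | insert i s hi ih =>
    rw [Finset.prod_insert hi, Finset.prod_insert hi, Finset.sum_insert hi]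
    have hp : |∏ j ∈ s, f j| ≤ 1 := by
      rw [Finset.abs_prod]; exact Finset.prod_le_one (fun _ _ => abs_nonneg _) fun j _ => hf j
    calc |f i * ∏ j ∈ s, f j - g i * ∏ j ∈ s, g j|
        = |(f i - g i) * ∏ j ∈ s, f j + g i * (∏ j ∈ s, f j - ∏ j ∈ s, g j)| := by ring_nf
      _ ≤ |f i - g i| * |∏ j ∈ s, f j| + |g i| * |∏ j ∈ s, f j - ∏ j ∈ s, g j| := by
          rw [← abs_mul, ← abs_mul]; exact abs_add_le _ _
      _ ≤ |f i - g i| * 1 + 1 * ∑ j ∈ s, |f j - g j| := by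
          gcongr
          exact hg i
      _ = _ := by ring

/-- The lift to `ℝ × ℝ` of the cocycle product over `n` steps of the rotation by `α`, without the
sign that makes it periodic in `τ`. -/
noncomputable def waveProd (α : ℝ) (n : ℕ) (τ x : ℝ) : ℝ :=
  ∏ i ∈ Finset.range n, (wave (x + i * α) * wave (x + i * α - τ))

/-- The mean of `waveProd` over the circle. -/
noncomputable def waveCorr (α : ℝ) (n : ℕ) (τ : ℝ) : ℝ := ∫ x in (0 : ℝ)..1, waveProd α n τ x

section
variable (α : ℝ) (n : ℕ)

theorem abs_waveProd (τ x : ℝ) : |waveProd α n τ x| = 1 := by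
  simp [waveProd, Finset.abs_prod, abs_mul, abs_wave]

theorem measurable_waveProd (τ : ℝ) : Measurable (waveProd α n τ) :=
  Finset.measurable_fun_prod _ fun _ _ =>
    (measurable_wave.comp (measurable_add_const _)).mul
      (measurable_wave.comp ((measurable_add_const _).sub_const _))

theorem intervalIntegrable_waveProd (τ : ℝ) :
    IntervalIntegrable (waveProd α n τ) volume 0 1 :=
  intervalIntegrable_of_bounded (measurable_waveProd α n τ) (fun x => (abs_waveProd α n τ x).le) _ _

theorem waveCorr_zero : waveCorr α n 0 = 1 := by
  simp [waveCorr, waveProd, wave_mul_self]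

theorem waveCorr_add_one (τ : ℝ) : waveCorr α n (τ + 1) = (-1) ^ n * waveCorr α n τ := by
  have h : ∀ x, waveProd α n (τ + 1) x = (-1) ^ n * waveProd α n τ x := fun x => by
    have : ∀ i : ℕ, wave (x + i * α - (τ + 1)) = -1 * wave (x + i * α - τ) := fun i => by
      rw [show x + i * α - (τ + 1) = x + i * α - τ + ((-1 : ℤ) : ℝ) by push_cast; ring,
        wave_add_int]
      norm_num
    simp only [waveProd, this, mul_left_comm, Finset.prod_mul_distrib (f := fun _ => (-1 : ℝ))]
    simp
  simp only [waveCorr, h, intervalIntegral.integral_const_mul]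

theorem abs_waveCorr_sub_le (τ τ' : ℝ) :
    |waveCorr α n τ - waveCorr α n τ'| ≤ 2 * n * |τ - τ'| := by
  have hw : ∀ c, Measurable fun x => wave (x + c) := fun c =>
    measurable_wave.comp (measurable_add_const c)
  have hi : ∀ i : ℕ, IntervalIntegrable
      (fun x => |wave (x + (i * α - τ)) - wave (x + (i * α - τ'))|) volume 0 1 := fun i => by
    refine intervalIntegrable_of_bounded (C := 2) ((hw _).sub (hw _)).abs (fun x => ?_) _ _
    have := abs_sub (wave (x + (i * α - τ))) (wave (x + (i * α - τ')))
    rw [abs_wave, abs_wave] at this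
    rw [abs_abs]; exact this.trans (by norm_num)
  have hd := (intervalIntegrable_waveProd α n τ).sub (intervalIntegrable_waveProd α n τ')
  rw [waveCorr, waveCorr, ← intervalIntegral.integral_sub (intervalIntegrable_waveProd α n τ)
    (intervalIntegrable_waveProd α n τ')]
  calc |∫ x in (0 : ℝ)..1, (waveProd α n τ x - waveProd α n τ' x)|
      ≤ ∫ x in (0 : ℝ)..1, |waveProd α n τ x - waveProd α n τ' x| :=
        intervalIntegral.abs_integral_le_integral_abs zero_le_one
    _ ≤ ∫ x in (0 : ℝ)..1, ∑ i ∈ Finset.range n,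
          |wave (x + (i * α - τ)) - wave (x + (i * α - τ'))| := by
        refine intervalIntegral.integral_mono_on zero_le_one hd.abs
          (by simpa only [Finset.sum_fn] using
            IntervalIntegrable.sum (Finset.range n) fun i _ => hi i) fun x _ => ?_
        refine (abs_prod_sub_prod_le _ (fun i => ?_) fun i => ?_).trans_eq
          (Finset.sum_congr rfl fun i _ => ?_)
        · simp [abs_mul, abs_wave]
        · simp [abs_mul, abs_wave]
        · rw [← mul_sub, abs_mul, abs_wave, one_mul, add_sub_assoc, add_sub_assoc]
    _ = ∑ i ∈ Finset.range n, ∫ x in (0 : ℝ)..1,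
          |wave (x + (i * α - τ)) - wave (x + (i * α - τ'))| :=
        intervalIntegral.integral_finsetSum fun i _ => hi i
    _ ≤ ∑ i ∈ Finset.range n, 2 * |τ - τ'| := by
        refine Finset.sum_le_sum fun i _ => (integral_abs_wave_sub_wave_le _ _).trans_eq ?_
        rw [sub_sub_sub_cancel_left, abs_sub_comm]
    _ = 2 * n * |τ - τ'| := by rw [Finset.sum_const, Finset.card_range, nsmul_eq_mul]; ring

/-- Moving `τ` by `α` makes the product telescope. -/
theorem waveProd_add (τ x : ℝ) : waveProd α n (τ + α) x =
    waveProd α n τ x * (wave (x + (-τ - α)) * wave (x + (-τ - α + n * α))) := by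
  induction n with
  | zero => simp [waveProd, wave_mul_self]
  | succ n ih =>
    have hs : ∀ τ, waveProd α (n + 1) τ x =
      waveProd α n τ x * (wave (x + n * α) * wave (x + n * α - τ)) := fun τ =>
        Finset.prod_range_succ _ _
    rw [hs, hs, ih, show x + n * α - (τ + α) = x + (-τ - α + n * α) by ring,
      show x + (-τ - α + (n + 1 : ℕ) * α) = x + n * α - τ by push_cast; ring]
    linear_combination waveProd α n τ x * wave (x + (-τ - α)) * wave (x + n * α) *
      wave_mul_self (x + (-τ - α + n * α)) - waveProd α n τ x * wave (x + (-τ - α)) *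
      wave (x + n * α) * wave_mul_self (x + n * α - τ)

/-- The means `waveCorr` are nearly invariant, up to sign, under `τ ↦ τ + α` at times `n` for which
`n * α` is close to an integer: the two ends of the telescoping product then cancel. -/
theorem abs_waveCorr_add_sub_le (τ : ℝ) (p : ℤ) :
    |waveCorr α n (τ + α) - (-1 : ℝ) ^ p * waveCorr α n τ| ≤ 2 * |n * α - p| := by
  have hi := intervalIntegrable_waveProd α n
  rw [waveCorr, waveCorr, ← intervalIntegral.integral_const_mul,
    ← intervalIntegral.integral_sub (hi _) ((hi _).const_mul _)]
  calc _ ≤ ∫ x in (0 : ℝ)..1, |waveProd α n (τ + α) x - (-1 : ℝ) ^ p * waveProd α n τ x| :=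
        intervalIntegral.abs_integral_le_integral_abs zero_le_one
    _ = ∫ x in (0 : ℝ)..1, |wave (x + (-τ - α + n * α)) - wave (x + (-τ - α + p))| := by
        congr 1; ext x
        rw [waveProd_add, ← add_assoc x _ (p : ℝ), wave_add_int]
        have h : wave (x + (-τ - α + n * α)) - (-1 : ℝ) ^ p * wave (x + (-τ - α)) =
            wave (x + (-τ - α)) * (wave (x + (-τ - α)) * wave (x + (-τ - α + n * α)) -
              (-1 : ℝ) ^ p) := by
          linear_combination (-wave (x + (-τ - α + n * α))) * wave_mul_self (x + (-τ - α))
        rw [h, abs_mul, abs_wave, one_mul, mul_comm ((-1 : ℝ) ^ p), ← mul_sub, abs_mul,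
          abs_waveProd, one_mul]
    _ ≤ _ := (integral_abs_wave_sub_wave_le _ _).trans_eq (by
        rw [add_sub_add_left_eq_sub])

theorem continuous_waveCorr : Continuous (waveCorr α n) := by
  refine (LipschitzWith.of_dist_le_mul (K := (2 * n : ℕ).cast) fun x y => ?_).continuous
  rw [Real.dist_eq, Real.dist_eq]
  simpa using abs_waveCorr_sub_le α n x y

/-- The continuous function `waveCorr α n` is `1` at `0`, and takes a nonpositive value: at `1` if
`n` is odd, and at `α` if `n` is even, since `p` is odd in this case. -/
theorem exists_waveCorr_eq_zero {p : ℤ} (hp : IsCoprime p (n : ℤ)) (h : |n * α - p| < 1 / 2) :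
    ∃ τ, waveCorr α n τ = 0 := by
  have hneg : ∃ τ, waveCorr α n τ ≤ 0 := by
    rcases Nat.even_or_odd n with he | ho
    · have hpo : Odd p := by
        rw [← Int.not_even_iff_odd]
        intro hpe
        have := hp.isUnit_of_dvd' hpe.two_dvd (by exact_mod_cast he.two_dvd)
        exact absurd (Int.isUnit_iff.1 this) (by norm_num)
      have h1 := abs_waveCorr_add_sub_le α n 0 p
      rw [waveCorr_zero, hpo.neg_one_zpow] at h1
      exact ⟨0 + α, by linarith [(abs_le.1 h1).2]⟩
    · refine ⟨0 + 1, ?_⟩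
      rw [waveCorr_add_one, waveCorr_zero, ho.neg_one_pow]
      norm_num
  obtain ⟨τ, hτ⟩ := hneg
  exact mem_range_of_exists_le_of_exists_ge (continuous_waveCorr α n) ⟨τ, hτ⟩
    ⟨0, by rw [waveCorr_zero]; exact zero_le_one⟩

theorem abs_abs_waveCorr_add_mul_sub_le (τ : ℝ) (p : ℤ) (j : ℕ) :
    |(|waveCorr α n (τ + j * α)| - |waveCorr α n τ|)| ≤ 2 * j * |n * α - p| := by
  induction j with
  | zero => simp
  | succ j ih =>
    have h1 := (abs_abs_sub_abs_le _ _).trans (abs_waveCorr_add_sub_le α n (τ + j * α) p)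
    rw [abs_mul, abs_zpow, abs_neg, abs_one, one_zpow, one_mul] at h1
    rw [show τ + (j + 1 : ℕ) * α = τ + j * α + α by push_cast; ring]
    refine (abs_sub_le _ |waveCorr α n (τ + j * α)| _).trans ?_
    push_cast
    linarith

end

/-- On the lifts to the line, the cocycle is a product of square waves. -/
theorem cocycle_coe (τ x : ℝ) : ((cocycle (τ : UnitAddCircle) (x : UnitAddCircle) : ℤ) : ℝ) =
    wave x * wave (x - τ) * wave τ := by
  have h1 : wave (x - τ) = (-1) ^ (⌊x⌋ - ⌊τ⌋) * wave (Int.fract x - Int.fract τ) := by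
    rw [← wave_add_int, Int.fract, Int.fract]; push_cast; congr 1; ring
  have h2 : ((cocycle (τ : UnitAddCircle) (x : UnitAddCircle) : ℤ) : ℝ) =
      wave (Int.fract x - Int.fract τ) := by
    have hx := Int.fract_nonneg x
    have hx' := Int.fract_lt_one x
    have ht := Int.fract_nonneg τ
    have ht' := Int.fract_lt_one τ
    unfold cocycle wave
    rw [rep_coe, rep_coe]
    split_ifs with h
    · rw [show ⌊Int.fract x - Int.fract τ⌋ = -1 by
        rw [Int.floor_eq_iff]; push_cast; constructor <;> linarith]
      norm_num
    · rw [show ⌊Int.fract x - Int.fract τ⌋ = 0 by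
        rw [Int.floor_eq_iff]; push_cast; constructor <;> linarith]
      norm_num
  rw [h1, h2, zpow_sub₀ (by norm_num), div_eq_mul_inv, ← inv_zpow]
  norm_num
  change _ = wave x * (wave x * wave τ * _) * wave τ
  linear_combination (-wave (Int.fract x - Int.fract τ)) * wave_mul_self x -
    (wave (Int.fract x - Int.fract τ)) * wave x * wave x * wave_mul_self τ

/-- The product of the cocycle along `n` steps of the rotation by `α`, as a real number. -/
noncomputable def cocycleProd (α : ℝ) (n : ℕ) (t s : UnitAddCircle) : ℝ :=
  ∏ i ∈ Finset.range n, ((cocycle t (s + ((i * α : ℝ) : UnitAddCircle)) : ℤ) : ℝ)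

/-- The mean over `s` of `cocycleProd α n t s`. -/
noncomputable def cocycleMean (α : ℝ) (n : ℕ) (t : UnitAddCircle) : ℝ :=
  ∫ s, cocycleProd α n t s

/-- In absolute value, the mean over the circle is the mean of the lifts: the remaining sign
depends on `τ` only. -/
theorem abs_cocycleMean_coe (α : ℝ) (n : ℕ) (τ : ℝ) :
    |cocycleMean α n (τ : UnitAddCircle)| = |waveCorr α n τ| := by
  have h : cocycleMean α n (τ : UnitAddCircle) = wave τ ^ n * waveCorr α n τ := by
    rw [cocycleMean, ← UnitAddCircle.intervalIntegral_preimage 0, waveCorr,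
      ← intervalIntegral.integral_const_mul, zero_add]
    congr 1; ext x
    simp only [cocycleProd, ← AddCircle.coe_add, cocycle_coe, waveProd, Finset.prod_mul_distrib]
    simp [mul_comm]
  rw [h, abs_mul, abs_pow, abs_wave, one_pow, one_mul]

theorem measurable_cocycleProd (α : ℝ) (n : ℕ) :
    Measurable fun q : UnitAddCircle × UnitAddCircle => cocycleProd α n q.1 q.2 := by
  refine Finset.measurable_fun_prod _ fun i _ => ?_
  exact measurable_units_coe.comp (measurable_cocycle.comp
    (measurable_fst.prodMk (measurable_snd.add_const _)))

theorem abs_cocycleProd (α : ℝ) (n : ℕ) (t s : UnitAddCircle) : |cocycleProd α n t s| = 1 := by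
  simp only [cocycleProd, Finset.abs_prod]
  exact Finset.prod_eq_one fun i _ => abs_units_coe _

theorem measurable_cocycleMean (α : ℝ) (n : ℕ) : Measurable (cocycleMean α n) :=
  (measurable_cocycleProd α n).stronglyMeasurable.integral_prod_right.measurable

theorem abs_cocycleMean_le_one (α : ℝ) (n : ℕ) (t : UnitAddCircle) : |cocycleMean α n t| ≤ 1 := by
  refine (norm_integral_le_of_norm_le_const (f := cocycleProd α n t) (C := 1)
    (ae_of_all _ fun s => (abs_cocycleProd α n t s).le)).trans ?_
  simp

theorem abs_abs_cocycleMean_rotation_sub_le (α : ℝ) (n : ℕ) (t : UnitAddCircle) (p : ℤ) :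
    |(|cocycleMean α n (rotation α t)| - |cocycleMean α n t|)| ≤ 2 * |n * α - p| := by
  rw [← coe_rep t, rotation, ← AddCircle.coe_add, abs_cocycleMean_coe, abs_cocycleMean_coe]
  simpa using abs_abs_waveCorr_add_mul_sub_le α n (rep t) p 1

/-- The multiples `iα` with `0 < i ≤ q/2` stay away from the integers when `q` is the denominator of
a good rational approximation `p/q` of `α`. -/
theorem one_div_le_abs_mul_sub {α : ℝ} {q : ℕ} {p : ℤ} (hq : 0 < q) (hp : IsCoprime p (q : ℤ))
    (h : |q * α - p| < 1 / q) {i : ℕ} (hi : 0 < i) (hiq : 2 * i ≤ q) (k : ℤ) :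
    1 / (2 * q : ℝ) ≤ |i * α - k| := by
  have hq' : (0 : ℝ) < q := by exact_mod_cast hq
  have hne : (i : ℤ) * p - k * q ≠ 0 := by
    intro h0
    have hd : (q : ℤ) ∣ i * p := ⟨k, by linarith⟩
    have := Int.le_of_dvd (by exact_mod_cast hi) (hp.symm.dvd_of_dvd_mul_right hd)
    omega
  have h1 : (1 : ℝ) ≤ |(i : ℝ) * p - k * q| := by exact_mod_cast Int.one_le_abs hne
  have h2 : (q : ℝ) * (i * α - k) = i * (q * α - p) + (i * p - k * q) := by ring
  have h3 : |(i : ℝ) * (q * α - p)| ≤ 1 / 2 := by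
    rw [abs_mul, Nat.abs_cast]
    have : (2 * i : ℝ) ≤ q := by exact_mod_cast hiq
    calc (i : ℝ) * |q * α - p| ≤ (q / 2) * (1 / q) := by gcongr; linarith
      _ = 1 / 2 := by field_simp
  have h4 : 1 / 2 ≤ (q : ℝ) * |i * α - k| := by
    have h5 : (q : ℝ) * |i * α - k| = |(q : ℝ) * (i * α - k)| := by rw [abs_mul, Nat.abs_cast]
    rw [h5, h2]
    have := abs_sub_abs_le_abs_sub ((i : ℝ) * p - k * q) (-(i * (q * α - p)))
    rw [abs_neg, sub_neg_eq_add, add_comm] at this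
    linarith
  rw [div_le_iff₀ (by positivity)]
  linarith

/-- Each value of `|cocycleMean α q|` is nearly attained on a set of measure bounded below: it
varies by at most `1/4` over the disjoint arcs of radius `1/(16q)` around the points
`τ + jα`, `0 ≤ j ≤ q/16`. -/
theorem measure_near_value_ge {α : ℝ} {q : ℕ} {p : ℤ} (hq : 0 < q) (hp : IsCoprime p (q : ℤ))
    (h : |q * α - p| < 1 / q) (τ : ℝ) :
    1 / 128 ≤ (volume : Measure UnitAddCircle).real
      {t | |(|cocycleMean α q t| - |waveCorr α q τ|)| ≤ 1 / 4} := by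
  have hq' : (0 : ℝ) < q := by exact_mod_cast hq
  set J := q / 16 + 1
  set r : ℝ := 1 / (16 * q)
  have hr : 0 < r := by positivity
  let c : ℕ → UnitAddCircle := fun j => ((τ + j * α : ℝ) : UnitAddCircle)
  have hsub : ⋃ j ∈ Finset.range J, Metric.closedBall (c j) r ⊆
      {t | |(|cocycleMean α q t| - |waveCorr α q τ|)| ≤ 1 / 4} := by
    refine Set.iUnion₂_subset fun j hj t ht => ?_
    have hj16 : (16 * j : ℝ) ≤ q := by
      have : 16 * j ≤ q := by have := Finset.mem_range.1 hj; omega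
      exact_mod_cast this
    obtain ⟨y, rfl⟩ := QuotientAddGroup.mk_surjective t
    rw [Metric.mem_closedBall, dist_eq_norm] at ht
    change ‖((y : ℝ) : UnitAddCircle) - ((τ + j * α : ℝ) : UnitAddCircle)‖ ≤ r at ht
    rw [← AddCircle.coe_sub, UnitAddCircle.norm_eq] at ht
    set m := round (y - (τ + j * α)) with hm
    have hy : ((y : ℝ) : UnitAddCircle) = ((y - m : ℝ) : UnitAddCircle) := by
      rw [AddCircle.coe_sub, (AddCircle.coe_eq_zero_iff (x := (m : ℝ)) 1).2 ⟨m, by simp⟩, sub_zero]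
    change |(|cocycleMean α q ((y : ℝ) : UnitAddCircle)| - |waveCorr α q τ|)| ≤ 1 / 4
    rw [hy, abs_cocycleMean_coe]
    refine (abs_sub_le _ |waveCorr α q (τ + j * α)| _).trans ?_
    have h1 := (abs_abs_sub_abs_le _ _).trans (abs_waveCorr_sub_le α q (y - m) (τ + j * α))
    have h2 := abs_abs_waveCorr_add_mul_sub_le α q τ p j
    have h3 : 2 * (q : ℝ) * |y - m - (τ + j * α)| ≤ 1 / 8 := by
      rw [sub_right_comm]
      calc 2 * (q : ℝ) * |y - (τ + j * α) - m| ≤ 2 * q * r := by gcongr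
        _ = 1 / 8 := by simp only [r]; field_simp; norm_num
    have h4 : 2 * (j : ℝ) * |q * α - p| ≤ 1 / 8 := by
      calc 2 * (j : ℝ) * |q * α - p| ≤ 2 * (q / 16) * (1 / q) := by gcongr; linarith
        _ = 1 / 8 := by field_simp; norm_num
    linarith
  have hdisj : (Finset.range J : Set ℕ).PairwiseDisjoint fun j => Metric.closedBall (c j) r := by
    have key : ∀ i j : ℕ, i < j → j < J →
        Disjoint (Metric.closedBall (c i) r) (Metric.closedBall (c j) r) := by
      intro i j hij hj
      refine Metric.closedBall_disjoint_closedBall ?_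
      rw [dist_comm, dist_eq_norm]
      simp only [c]
      rw [← AddCircle.coe_sub, UnitAddCircle.norm_eq,
        show τ + j * α - (τ + i * α) = (j - i : ℕ) * α by rw [Nat.cast_sub hij.le]; ring]
      refine lt_of_lt_of_le ?_ (one_div_le_abs_mul_sub hq hp h (by omega) (by omega) _)
      simp only [r]
      rw [← add_div, div_lt_div_iff₀ (by positivity) (by positivity)]
      linarith
    intro i hi j hj hij
    rcases lt_or_gt_of_ne hij with hlt | hlt
    · exact key i j hlt (Finset.mem_range.1 hj)
    · exact (key j i hlt (Finset.mem_range.1 hi)).symm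
  refine le_trans ?_ (measureReal_mono hsub)
  rw [measureReal_biUnion_finset hdisj fun _ _ => Metric.isClosed_closedBall.measurableSet]
  have hball : ∀ j, (volume : Measure UnitAddCircle).real (Metric.closedBall (c j) r) =
      2 * r := fun j => by
    have : 2 * r ≤ 1 := by
      have h1 : (1 : ℝ) ≤ q := by exact_mod_cast hq
      simp only [r]
      rw [mul_one_div, div_le_one (by positivity)]
      linarith
    rw [Measure.real, AddCircle.volume_closedBall, min_eq_right this,
      ENNReal.toReal_ofReal (by positivity)]
  simp only [hball, Finset.sum_const, Finset.card_range, nsmul_eq_mul]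
  have hJ : (q : ℝ) ≤ 16 * J := by
    have : q ≤ 16 * J := by omega
    exact_mod_cast this
  calc (1 / 128 : ℝ) = q / 16 * (2 * r) := by simp only [r]; field_simp; norm_num
    _ ≤ J * (2 * r) := by gcongr; linarith

/-- `|cocycleMean α q|` is far, in mean, from every constant when `q` is the denominator of a good
rational approximation of `α`: it nearly attains both values `0` and `1` on large sets. -/
theorem integral_abs_cocycleMean_sub_ge {α : ℝ} {q : ℕ} {p : ℤ} (hq : 2 ≤ q)
    (hp : IsCoprime p (q : ℤ)) (h : |q * α - p| < 1 / q) (a : ℝ) :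
    1 / 512 ≤ ∫ t, |(|cocycleMean α q t| - a)| := by
  have hq0 : 0 < q := by omega
  have hm : Measurable fun t => |(|cocycleMean α q t| - a)| :=
    ((measurable_cocycleMean α q).abs.sub_const a).abs
  have hint : Integrable (fun t => |(|cocycleMean α q t| - a)|) := by
    refine Integrable.of_bound hm.aestronglyMeasurable (1 + |a|) (ae_of_all _ fun t => ?_)
    rw [Real.norm_eq_abs, abs_abs]
    refine (abs_sub _ _).trans ?_
    rw [abs_abs]
    linarith [abs_cocycleMean_le_one α q t]
  -- a value at distance at least `1/2` from `a`
  obtain ⟨τ, hτ⟩ : ∃ τ, 1 / 2 ≤ |(|waveCorr α q τ| - a)| := by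
    rcases le_total a (1 / 2) with ha | ha
    · refine ⟨0, ?_⟩
      rw [waveCorr_zero, abs_one]
      exact le_trans (by linarith) (le_abs_self _)
    · have hq2 : (2 : ℝ) ≤ q := by exact_mod_cast hq
      obtain ⟨τ, hτ⟩ := exists_waveCorr_eq_zero α q hp
        (h.trans_le (one_div_le_one_div_of_le two_pos hq2))
      refine ⟨τ, ?_⟩
      rw [hτ, abs_zero, zero_sub, abs_neg]
      exact ha.trans (le_abs_self _)
  set A := {t | |(|cocycleMean α q t| - |waveCorr α q τ|)| ≤ 1 / 4}
  have hA := measure_near_value_ge hq0 hp h τ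
  have hsub : A ⊆ {t | 1 / 4 ≤ |(|cocycleMean α q t| - a)|} := fun t ht => by
    have h1 : |(|cocycleMean α q t| - |waveCorr α q τ|)| ≤ 1 / 4 := ht
    have h2 := abs_sub_le |waveCorr α q τ| |cocycleMean α q t| a
    rw [abs_sub_comm] at h1
    change 1 / 4 ≤ |(|cocycleMean α q t| - a)|
    linarith
  have h1 := mul_meas_ge_le_integral_of_nonneg (ae_of_all _ fun t => abs_nonneg _) hint (1 / 4)
  have h2 := measureReal_mono (μ := (volume : Measure UnitAddCircle)) hsub
  linarith

/-- Arbitrarily large denominators of good rational approximations. -/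
theorem exists_good_approximation {α : ℝ} (hα : Irrational α) (N : ℕ) :
    ∃ (q : ℕ) (p : ℤ), N < q ∧ IsCoprime p (q : ℤ) ∧ |q * α - p| < 1 / q := by
  by_contra! hcon
  refine Real.infinite_rat_abs_sub_lt_one_div_den_sq_of_irrational hα ?_
  set M := ⌈(|α| + 1) * N⌉
  refine (((Set.finite_Icc (-M) M).prod (Set.finite_Iic N)).image
    fun x : ℤ × ℕ => (x.1 / x.2 : ℚ)).subset fun x hx => ?_
  have hd : (0 : ℝ) < x.den := by exact_mod_cast x.pos
  have hd1 : (1 : ℝ) ≤ x.den := by exact_mod_cast x.pos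
  have hx' : |α - x| < 1 / (x.den : ℝ) ^ 2 := hx
  have hnum : (x.den : ℝ) * x = x.num := by exact_mod_cast Rat.den_mul_eq_num x
  have hN : x.den ≤ N := by
    by_contra! hN
    refine (hcon x.den x.num hN
      (Int.isCoprime_iff_nat_coprime.2 (by simpa using x.reduced))).not_gt ?_
    rw [← hnum, ← mul_sub, abs_mul, Nat.abs_cast]
    calc (x.den : ℝ) * |α - x| < x.den * (1 / (x.den : ℝ) ^ 2) := by gcongr
      _ = 1 / x.den := by field_simp
  have hN' : (x.den : ℝ) ≤ N := by exact_mod_cast hN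
  have h1 : |(x : ℝ)| ≤ |α| + 1 := by
    have h2 := abs_sub_abs_le_abs_sub (x : ℝ) α
    rw [abs_sub_comm] at h2
    have h3 : 1 / (x.den : ℝ) ^ 2 ≤ 1 := by
      rw [div_le_one (by positivity)]; exact one_le_pow₀ hd1
    linarith
  have hM : |x.num| ≤ M := by
    have : (|x.num| : ℝ) ≤ (|α| + 1) * N := by
      rw [← hnum, abs_mul, Nat.abs_cast, mul_comm]
      gcongr
    exact_mod_cast this.trans (Int.le_ceil _)
  exact ⟨(x.num, x.den), ⟨abs_le.1 hM, hN⟩, Rat.num_div_den x⟩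

/-! ### Conditional means and translations -/

theorem integrable_of_abs_le {Ω : Type*} [MeasurableSpace Ω] {P : Measure Ω} [IsFiniteMeasure P]
    {f : Ω → ℝ} (hf : Measurable f) {C : ℝ} (h : ∀ ω, |f ω| ≤ C) : Integrable f P :=
  Integrable.of_bound hf.aestronglyMeasurable C (ae_of_all _ h)

theorem integral_comp_of_measurePreserving {X Y : Type*} [MeasurableSpace X] [MeasurableSpace Y]
    {P : Measure X} {Q : Measure Y} {T : X → Y} (hT : MeasurePreserving T P Q) {f : Y → ℝ}
    (hf : Measurable f) : ∫ x, f (T x) ∂P = ∫ y, f y ∂Q := by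
  rw [← hT.map_eq, integral_map hT.aemeasurable hf.aestronglyMeasurable]

/-- The conditional expectation of a bounded function given `Z`, as a function of `Z`. -/
theorem exists_conditional_mean {Ω E : Type*} [MeasurableSpace Ω] [mE : MeasurableSpace E]
    (P : Measure Ω) [IsProbabilityMeasure P] {Z : Ω → E} (hZ : Measurable Z) {f : Ω → ℝ}
    (hf : Measurable f) (hf1 : ∀ ω, |f ω| ≤ 1) :
    ∃ K : E → ℝ, Measurable K ∧ (∀ z, |K z| ≤ 1) ∧
      ∀ (h : E → ℝ) (C : ℝ), Measurable h → (∀ z, |h z| ≤ C) →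
        ∫ ω, f ω * h (Z ω) ∂P = ∫ z, K z * h z ∂P.map Z := by
  obtain ⟨K₀, hK₀, hK⟩ := (stronglyMeasurable_condExp (μ := P) (m := mE.comap Z)
    (f := f)).measurable.exists_eq_measurable_comp
  have hK1 : ∀ᵐ ω ∂P, |K₀ (Z ω)| ≤ 1 := by
    filter_upwards [ae_bdd_abs_condExp_of_ae_bdd_abs (R := 1) (m := mE.comap Z) (μ := P) (f := f)
      (ae_of_all _ hf1)] with ω hω
    rw [hK] at hω
    simpa using hω
  refine ⟨fun z => max (-1) (min 1 (K₀ z)), by fun_prop, fun z => abs_le.2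
    ⟨le_max_left _ _, max_le (by norm_num) (min_le_left _ _)⟩, fun h C hh hC => ?_⟩
  have hZm : Measurable[mE.comap Z] Z := comap_measurable Z
  have hfi : Integrable f P := integrable_of_abs_le hf hf1
  have hfh : Integrable (f * (h ∘ Z)) P := by
    refine integrable_of_abs_le (C := C) (hf.mul (hh.comp hZ)) fun ω => ?_
    simp only [Pi.mul_apply, abs_mul, Function.comp]
    calc |f ω| * |h (Z ω)| ≤ 1 * C := by
          gcongr
          · exact hf1 ω
          · exact hC _
      _ = C := one_mul C
  have hpull := condExp_mul_of_stronglyMeasurable_right (μ := P) (m := mE.comap Z)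
    (f := f) (g := h ∘ Z) (hh.comp hZm).stronglyMeasurable hfh hfi
  rw [integral_map hZ.aemeasurable (by fun_prop)]
  calc ∫ ω, f ω * h (Z ω) ∂P = ∫ ω, (P[f * (h ∘ Z) | mE.comap Z]) ω ∂P :=
        (integral_condExp hZ.comap_le).symm
    _ = _ := by
      refine integral_congr_ae ?_
      filter_upwards [hpull, hK1] with ω h1 h2
      rw [h1, Pi.mul_apply, hK, Function.comp, Function.comp, min_eq_right (abs_le.1 h2).2,
        max_eq_right (abs_le.1 h2).1]

/-- The conditional mean of a function that transforms by a `±1`-valued cocycle transforms by the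
same cocycle, even if the underlying transformation is not invertible. -/
theorem conditional_mean_equivariant {Ω E : Type*} [MeasurableSpace Ω] [MeasurableSpace E]
    {P : Measure Ω} [IsProbabilityMeasure P] {Z : Ω → E} (hZ : Measurable Z) {f : Ω → ℝ}
    {K : E → ℝ} (hKm : Measurable K) (hK1 : ∀ z, |K z| ≤ 1)
    (hK : ∀ (h : E → ℝ) (C : ℝ), Measurable h → (∀ z, |h z| ≤ C) →
        ∫ ω, f ω * h (Z ω) ∂P = ∫ z, K z * h z ∂P.map Z)
    (hf : Measurable f) {τ : Ω → Ω} (hτ : MeasurePreserving τ P P) {R : E → E}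
    (hR : MeasurePreserving R (P.map Z) (P.map Z)) (hRZ : ∀ ω, Z (τ ω) = R (Z ω)) {c : E → ℝ}
    (hc : Measurable c) (hc1 : ∀ z, |c z| = 1) (hfc : ∀ᵐ ω ∂P, f (τ ω) = f ω * c (Z ω)) :
    ∀ᵐ z ∂P.map Z, K (R z) = c z * K z := by
  have := Measure.isProbabilityMeasure_map (μ := P) hZ.aemeasurable
  have hKR : Measurable fun z => K (R z) := hKm.comp hR.measurable
  have hc2 : ∀ z, c z * c z = 1 := fun z => by rw [← abs_mul_abs_self, hc1, one_mul]
  have hsq : ∀ z, |K z * K z| ≤ 1 := fun z => by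
    rw [abs_mul]; exact mul_le_one₀ (hK1 z) (abs_nonneg _) (hK1 z)
  have hcr : ∀ z, |K z * (c z * K (R z))| ≤ 1 := fun z => by
    rw [abs_mul, abs_mul, hc1, one_mul]; exact mul_le_one₀ (hK1 z) (abs_nonneg _) (hK1 _)
  have I1 : ∫ z, K (R z) * K (R z) ∂P.map Z = ∫ z, K z * K z ∂P.map Z :=
    integral_comp_of_measurePreserving hR (hKm.mul hKm)
  have I2 : ∫ z, K z * (c z * K (R z)) ∂P.map Z = ∫ z, K z * K z ∂P.map Z := by
    rw [← hK (fun z => c z * K (R z)) 1 (hc.mul hKR) fun z => by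
        rw [abs_mul, hc1, one_mul]; exact hK1 _,
      ← hK _ 1 hKm hK1]
    have hm : AEStronglyMeasurable (fun ω => f ω * K (Z ω)) (P.map τ) := by
      have := hKm.comp hZ
      exact (hf.mul this).aestronglyMeasurable
    conv_rhs => rw [← hτ.map_eq, integral_map hτ.aemeasurable hm]
    refine integral_congr_ae (hfc.mono fun ω h => ?_)
    simp only [h, hRZ]
    ring
  have i1 : Integrable (fun z => K (R z) * K (R z)) (P.map Z) :=
    integrable_of_abs_le (hKR.mul hKR) fun z => hsq (R z)
  have i2 : Integrable (fun z => K z * (c z * K (R z))) (P.map Z) :=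
    integrable_of_abs_le (hKm.mul (hc.mul hKR)) hcr
  have i3 : Integrable (fun z => K z * K z) (P.map Z) :=
    integrable_of_abs_le (hKm.mul hKm) hsq
  have i12 : Integrable (fun z => K (R z) * K (R z) - 2 * (K z * (c z * K (R z)))) (P.map Z) :=
    i1.sub (i2.const_mul 2)
  have hexp : ∀ z, (K (R z) - c z * K z) ^ 2 =
      K (R z) * K (R z) - 2 * (K z * (c z * K (R z))) + K z * K z := fun z => by
    linear_combination K z * K z * hc2 z
  have h0 : ∫ z, (K (R z) - c z * K z) ^ 2 ∂P.map Z = 0 := by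
    simp only [hexp]
    rw [integral_add i12 i3, integral_sub i1 (i2.const_mul 2),
      integral_const_mul, I1, I2]
    ring
  have hi : Integrable (fun z => (K (R z) - c z * K z) ^ 2) (P.map Z) := by
    simp only [hexp]
    exact i12.add i3
  have := (integral_eq_zero_iff_of_nonneg (fun z => sq_nonneg _) hi).1 h0
  exact this.mono fun z hz => sub_eq_zero.1 (pow_eq_zero_iff two_ne_zero |>.1 hz)

section Translation

variable {E : Type*} [SeminormedAddCommGroup E] [MeasurableSpace E] [BorelSpace E]
  {P : Measure E} [IsFiniteMeasure P] {v : E}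

omit [BorelSpace E] [IsFiniteMeasure P] in
theorem measurePreserving_add_nsmul (hv : MeasurePreserving (fun x => x + v) P P) (n : ℕ) :
    MeasurePreserving (fun x => x + n • v) P P := by
  induction n with
  | zero => simpa using! MeasurePreserving.id P
  | succ n ih =>
    have := hv.comp ih
    simpa only [Function.comp_def, add_assoc, ← succ_nsmul] using this

/-- Translations along a sequence tending to `0` of multiples of a measure-preserving translation
act continuously in `L¹`. -/
theorem tendsto_integral_abs_translate_sub (hv : MeasurePreserving (fun x => x + v) P P)
    {u : ℕ → ℕ} (hu : Tendsto (fun k => u k • v) atTop (𝓝 0)) {f : E → ℝ} (hf : Integrable f P) :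
    Tendsto (fun k => ∫ x, |f (x + u k • v) - f x| ∂P) atTop (𝓝 0) := by
  rw [Metric.tendsto_atTop]
  intro ε hε
  obtain ⟨g, hg, hgi⟩ := hf.exists_boundedContinuous_integral_sub_le (ε := ε / 3) (by positivity)
  have hlim : Tendsto (fun k => ∫ x, |g (x + u k • v) - g x| ∂P) atTop (𝓝 0) := by
    have := tendsto_integral_of_dominated_convergence (μ := P)
      (F := fun k x => |g (x + u k • v) - g x|) (f := fun _ => (0 : ℝ)) (fun _ => ‖g‖ + ‖g‖)
      (fun k => Measurable.aestronglyMeasurable (by fun_prop)) (integrable_const _)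
      (fun k => ae_of_all _ fun x => ?_) (ae_of_all _ fun x => ?_)
    · simpa using this
    · rw [Real.norm_eq_abs, abs_abs]
      exact (abs_sub _ _).trans (add_le_add (g.norm_coe_le_norm _) (g.norm_coe_le_norm _))
    · have h1 : Tendsto (fun k => g (x + u k • v)) atTop (𝓝 (g (x + 0))) :=
        (g.continuous.tendsto _).comp (tendsto_const_nhds.add hu)
      rw [add_zero] at h1
      simpa using (h1.sub_const (g x)).abs
  obtain ⟨N, hN⟩ := Metric.tendsto_atTop.1 hlim (ε / 3) (by positivity)
  refine ⟨N, fun k hk => ?_⟩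
  have hp := measurePreserving_add_nsmul hv (u k)
  have hgk := hN k hk
  rw [Real.dist_eq, sub_zero] at hgk ⊢
  rw [abs_of_nonneg (integral_nonneg fun x => abs_nonneg _)] at hgk ⊢
  have hfg : Integrable (fun x => |f x - g x|) P := (hf.sub hgi).abs
  have hfgk : Integrable (fun x => |f (x + u k • v) - g (x + u k • v)|) P :=
    hp.integrable_comp_of_integrable hfg
  have hggk : Integrable (fun x => |g (x + u k • v) - g x|) P :=
    ((hp.integrable_comp_of_integrable hgi).sub hgi).abs
  have hsum : Integrable
      (fun x => |f (x + u k • v) - g (x + u k • v)| + |g (x + u k • v) - g x|) P := hfgk.add hggk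
  have heq : ∫ x, |f (x + u k • v) - g (x + u k • v)| ∂P = ∫ x, |f x - g x| ∂P :=
    (integral_map (f := fun x => |f x - g x|) hp.aemeasurable
      (by rw [hp.map_eq]; exact hfg.aestronglyMeasurable)).symm.trans (by rw [hp.map_eq])
  calc ∫ x, |f (x + u k • v) - f x| ∂P
      ≤ ∫ x, (|f (x + u k • v) - g (x + u k • v)| + |g (x + u k • v) - g x| + |f x - g x|) ∂P := by
        refine integral_mono ((hp.integrable_comp_of_integrable hf).sub hf).abs
          (hsum.add hfg) fun x => ?_
        have h1 := abs_sub_le (f (x + u k • v)) (g (x + u k • v)) (f x)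
        have h2 := abs_sub_le (g (x + u k • v)) (g x) (f x)
        rw [abs_sub_comm (g x)] at h2
        change |f (x + u k • v) - f x| ≤ _
        linarith
    _ = ∫ x, |f x - g x| ∂P + ∫ x, |g (x + u k • v) - g x| ∂P + ∫ x, |f x - g x| ∂P := by
        rw [integral_add hsum hfg, integral_add hfgk hggk, heq]
    _ < ε := by
        simp only [Real.norm_eq_abs] at hg
        linarith

/-- A finite measure invariant under a translation is invariant under the closed subgroup that
it generates. -/
theorem measurePreserving_add_of_mem_closure (hv : MeasurePreserving (fun x => x + v) P P) {w : E}
    (hw : w ∈ closure (Set.range fun n : ℕ => n • v)) :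
    MeasurePreserving (fun x => x + w) P P := by
  refine ⟨by fun_prop, ?_⟩
  refine ext_of_forall_integral_eq_of_IsFiniteMeasure fun g => ?_
  rw [integral_map (by fun_prop) g.continuous.measurable.aestronglyMeasurable]
  have hc : Continuous fun w : E => ∫ x, g (x + w) ∂P :=
    continuous_of_dominated (bound := fun _ => ‖g‖)
      (fun w => Measurable.aestronglyMeasurable (by fun_prop))
      (fun w => ae_of_all _ fun x => g.norm_coe_le_norm _) (integrable_const _)
      (ae_of_all _ fun x => by fun_prop)
  have hcl : IsClosed {w : E | ∫ x, g (x + w) ∂P = ∫ x, g x ∂P} :=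
    isClosed_eq hc continuous_const
  refine closure_minimal ?_ hcl hw
  rintro _ ⟨n, rfl⟩
  exact integral_comp_of_measurePreserving (measurePreserving_add_nsmul hv n)
    g.continuous.measurable

end Translation

/-! ### Relatively independent self-joinings and rigid translations -/

section SelfJoining

variable {Y E : Type*} [MeasurableSpace Y] [MeasurableSpace E] [StandardBorelSpace E] [Nonempty E]
  (ζ : Measure (Y × E)) [IsProbabilityMeasure ζ]

/-- The conditional mean of a function of the second coordinate, given the first one. -/
noncomputable def condMean (f : E → ℝ) (y : Y) : ℝ := ∫ x, f x ∂ζ.condKernel y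

theorem measurable_condMean {f : E → ℝ} (hf : Measurable f) : Measurable (condMean ζ f) :=
  (hf.comp measurable_snd).stronglyMeasurable.integral_kernel_prod_right'.measurable

theorem abs_condMean_le {f : E → ℝ} {C : ℝ} (h : ∀ x, |f x| ≤ C) (y : Y) :
    |condMean ζ f y| ≤ C := by
  refine (norm_integral_le_of_norm_le_const (f := f) (ae_of_all _ h)).trans ?_
  simp

/-- `condMean` has the defining property of the conditional expectation. -/
theorem integral_mul_condMean {f : E → ℝ} (hf : Measurable f) {C : ℝ} (hC : ∀ x, |f x| ≤ C)
    {h : Y → ℝ} (hh : Measurable h) {D : ℝ} (hD : ∀ y, |h y| ≤ D) :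
    ∫ z, h z.1 * f z.2 ∂ζ = ∫ y, h y * condMean ζ f y ∂ζ.fst := by
  have hi : Integrable (fun z : Y × E => h z.1 * f z.2) (ζ.fst ⊗ₘ ζ.condKernel) := by
    refine integrable_of_abs_le (C := D * C)
      ((hh.comp measurable_fst).mul (hf.comp measurable_snd)) fun z => ?_
    rw [abs_mul]
    exact mul_le_mul (hD _) (hC _) (abs_nonneg _) ((abs_nonneg _).trans (hD z.1))
  conv_lhs => rw [← ζ.disintegrate ζ.condKernel]
  rw [Measure.integral_compProd hi]
  simp only [integral_const_mul, condMean]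

/-- The relatively independent self-joining over the first coordinate of a measure on `Y × E`. -/
noncomputable def selfJoining : Measure (Y × E × E) :=
  ζ.fst ⊗ₘ (ζ.condKernel ×ₖ ζ.condKernel)

instance : IsProbabilityMeasure (selfJoining ζ) := by unfold selfJoining; infer_instance

theorem selfJoining_apply {s : Set Y} {t u : Set E} (hs : MeasurableSet s) (ht : MeasurableSet t)
    (hu : MeasurableSet u) : selfJoining ζ (s ×ˢ t ×ˢ u) =
      ∫⁻ y in s, ζ.condKernel y t * ζ.condKernel y u ∂ζ.fst := by
  rw [selfJoining, Measure.compProd_apply_prod hs (ht.prod hu)]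
  simp only [Kernel.prod_apply_prod]

theorem setLIntegral_condKernel {s : Set Y} {t : Set E} (hs : MeasurableSet s)
    (ht : MeasurableSet t) : ∫⁻ y in s, ζ.condKernel y t ∂ζ.fst = ζ (s ×ˢ t) := by
  conv_rhs => rw [← ζ.disintegrate ζ.condKernel, Measure.compProd_apply_prod hs ht]

theorem measurePreserving_selfJoining_fst :
    MeasurePreserving (fun q : Y × E × E => (q.1, q.2.1)) (selfJoining ζ) ζ := by
  refine ⟨by fun_prop, ?_⟩
  have : IsProbabilityMeasure ((selfJoining ζ).map fun q : Y × E × E => (q.1, q.2.1)) :=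
    Measure.isProbabilityMeasure_map (by fun_prop)
  refine Measure.ext_prod fun {s t} hs ht => ?_
  rw [Measure.map_apply (by fun_prop) (hs.prod ht),
    show (fun q : Y × E × E => (q.1, q.2.1)) ⁻¹' s ×ˢ t = s ×ˢ t ×ˢ Set.univ by ext; simp,
    selfJoining_apply ζ hs ht .univ, ← setLIntegral_condKernel ζ hs ht]
  simp

theorem measurePreserving_selfJoining_snd :
    MeasurePreserving (fun q : Y × E × E => (q.1, q.2.2)) (selfJoining ζ) ζ := by
  refine ⟨by fun_prop, ?_⟩
  have : IsProbabilityMeasure ((selfJoining ζ).map fun q : Y × E × E => (q.1, q.2.2)) :=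
    Measure.isProbabilityMeasure_map (by fun_prop)
  refine Measure.ext_prod fun {s t} hs ht => ?_
  rw [Measure.map_apply (by fun_prop) (hs.prod ht),
    show (fun q : Y × E × E => (q.1, q.2.2)) ⁻¹' s ×ˢ t = s ×ˢ Set.univ ×ˢ t by
      ext; simp, selfJoining_apply ζ hs .univ ht, ← setLIntegral_condKernel ζ hs ht]
  simp

/-- The mean over the self-joining of a product of two copies of `K` is the mean square of the
conditional mean of `K`. -/
theorem integral_selfJoining_mul {K : Y × E → ℝ} (hK : Measurable K) (hK1 : ∀ z, |K z| ≤ 1) :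
    ∫ q, K (q.1, q.2.1) * K (q.1, q.2.2) ∂selfJoining ζ =
      ∫ y, (∫ x, K (y, x) ∂ζ.condKernel y) ^ 2 ∂ζ.fst := by
  have hi : Integrable (fun q : Y × E × E => K (q.1, q.2.1) * K (q.1, q.2.2)) (selfJoining ζ) := by
    refine integrable_of_abs_le (C := 1) (by fun_prop) fun q => ?_
    rw [abs_mul]
    exact mul_le_one₀ (hK1 _) (abs_nonneg _) (hK1 _)
  rw [selfJoining, Measure.integral_compProd hi]
  congr 1; ext y
  rw [Kernel.prod_apply, sq]
  exact integral_prod_mul (fun x => K (y, x)) fun x => K (y, x)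

variable {S : Y → Y} {R : E → E} (hS : Measurable S) (hR : Measurable R)
  (hζ : MeasurePreserving (Prod.map S R) ζ ζ)
include hS hζ

omit [StandardBorelSpace E] [Nonempty E] [IsProbabilityMeasure ζ] in
theorem measurePreserving_fst_of_prodMap : MeasurePreserving S ζ.fst ζ.fst := by
  refine ⟨hS, ?_⟩
  conv_rhs => rw [← hζ.map_eq]
  rw [Measure.fst, Measure.fst, Measure.map_map hS measurable_fst,
    Measure.map_map measurable_fst hζ.measurable]
  rfl

include hR

/-- The conditional mean of the shifted function has the larger `L²` norm; equality in this
inequality means equivariance. -/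
theorem integral_sq_condMean_comp_sub {f : E → ℝ} (hf : Measurable f) (hf1 : ∀ x, |f x| ≤ 1) :
    ∫ y, (condMean ζ (fun x => f (R x)) y - condMean ζ f (S y)) ^ 2 ∂ζ.fst =
      ∫ y, condMean ζ (fun x => f (R x)) y ^ 2 ∂ζ.fst - ∫ y, condMean ζ f y ^ 2 ∂ζ.fst := by
  have hSp := measurePreserving_fst_of_prodMap ζ hS hζ
  set a := condMean ζ fun x => f (R x)
  set b := condMean ζ f
  have ha : Measurable a := measurable_condMean ζ (hf.comp hR)
  have hb : Measurable b := measurable_condMean ζ hf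
  have ha1 : ∀ y, |a y| ≤ 1 := abs_condMean_le ζ fun x => hf1 _
  have hb1 : ∀ y, |b y| ≤ 1 := abs_condMean_le ζ hf1
  have hsq : ∀ {r : ℝ}, |r| ≤ 1 → |r ^ 2| ≤ 1 := fun {r} hr => by
    rw [abs_pow]; exact pow_le_one₀ (abs_nonneg _) hr
  have hbS : Measurable fun y => b (S y) := hb.comp hS
  have i1 : Integrable (fun y => a y ^ 2) ζ.fst :=
    integrable_of_abs_le (ha.pow_const 2) fun y => hsq (ha1 y)
  have i2 : Integrable (fun y => b (S y) * a y) ζ.fst :=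
    integrable_of_abs_le (C := 1) (hbS.mul ha) fun y => by
      rw [abs_mul]; exact mul_le_one₀ (hb1 _) (abs_nonneg _) (ha1 _)
  have i3 : Integrable (fun y => b (S y) ^ 2) ζ.fst :=
    integrable_of_abs_le (hbS.pow_const 2) fun y => hsq (hb1 _)
  have i12 : Integrable (fun y => a y ^ 2 - 2 * (b (S y) * a y)) ζ.fst := i1.sub (i2.const_mul 2)
  have I0 : ∫ z, b (S z.1) * f (R z.2) ∂ζ = ∫ z, b z.1 * f z.2 ∂ζ :=
    integral_comp_of_measurePreserving hζ (f := fun z => b z.1 * f z.2) (by fun_prop)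
  have I2 : ∫ y, b (S y) * a y ∂ζ.fst = ∫ y, b y ^ 2 ∂ζ.fst := by
    rw [← integral_mul_condMean ζ (f := fun x => f (R x)) (hf.comp hR) (fun x => hf1 _) hbS
        fun y => hb1 _,
      I0, integral_mul_condMean ζ hf hf1 hb hb1]
    simp only [sq, b]
  have I3 : ∫ y, b (S y) ^ 2 ∂ζ.fst = ∫ y, b y ^ 2 ∂ζ.fst :=
    integral_comp_of_measurePreserving hSp (hb.pow_const 2)
  have hexp : ∀ y, (a y - b (S y)) ^ 2 = a y ^ 2 - 2 * (b (S y) * a y) + b (S y) ^ 2 :=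
    fun y => by ring
  simp only [hexp]
  rw [integral_add i12 i3, integral_sub i1 (i2.const_mul 2), integral_const_mul, I2, I3]
  ring

end SelfJoining

section Rigid

variable {Y E : Type*} [MeasurableSpace Y] [SeminormedAddCommGroup E] [MeasurableSpace E]
  [BorelSpace E] [StandardBorelSpace E]
  (ζ : Measure (Y × E)) [IsProbabilityMeasure ζ]
  {S : Y → Y} {v : E} (hS : Measurable S)
  (hζ : MeasurePreserving (Prod.map S fun x => x + v) ζ ζ)
  {u : ℕ → ℕ} (hu1 : ∀ k, 1 ≤ u k) (hu : Tendsto (fun k => u k • v) atTop (𝓝 0))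
include hS hζ hu1 hu

/-- Conditional means given the first coordinate are equivariant, though `S` need not be
invertible: their `L²` norms increase along the orbit, and return to the initial value along the
times at which the translation is close to the identity. -/
theorem condMean_translate {f : E → ℝ} (hf : Measurable f) (hf1 : ∀ x, |f x| ≤ 1) :
    ∀ᵐ y ∂ζ.fst, condMean ζ (fun x => f (x + v)) y = condMean ζ f (S y) := by
  have hR : Measurable fun x : E => x + v := by fun_prop
  have hv : MeasurePreserving (fun x => x + v) ζ.snd ζ.snd := by
    refine ⟨hR, ?_⟩
    conv_rhs => rw [← hζ.map_eq]
    rw [Measure.snd, Measure.snd, Measure.map_map hR measurable_snd,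
      Measure.map_map measurable_snd hζ.measurable]
    rfl
  have hfm : ∀ n : ℕ, Measurable fun x => f (x + n • v) := fun n => hf.comp (by fun_prop)
  have hstep : ∀ g : E → ℝ, Measurable g → (∀ x, |g x| ≤ 1) →
      ∫ y, condMean ζ g y ^ 2 ∂ζ.fst ≤ ∫ y, condMean ζ (fun x => g (x + v)) y ^ 2 ∂ζ.fst := by
    intro g hg hg1
    have := integral_sq_condMean_comp_sub ζ hS hR hζ hg hg1
    have h0 : 0 ≤ ∫ y, (condMean ζ (fun x => g (x + v)) y - condMean ζ g (S y)) ^ 2 ∂ζ.fst :=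
      integral_nonneg fun y => sq_nonneg _
    linarith
  let a : ℕ → ℝ := fun n => ∫ y, condMean ζ (fun x => f (x + n • v)) y ^ 2 ∂ζ.fst
  have hmono : Monotone a := by
    refine monotone_nat_of_le_succ fun n => ?_
    have := hstep _ (hfm n) fun x => hf1 _
    simpa only [a, add_assoc, succ_nsmul'] using this
  have hlim : Tendsto (fun k => a (u k)) atTop (𝓝 (a 0)) := by
    rw [tendsto_iff_norm_sub_tendsto_zero]
    have hfi : Integrable f ζ.snd := integrable_of_abs_le hf hf1
    have hL := (tendsto_integral_abs_translate_sub hv hu hfi).const_mul 2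
    rw [mul_zero] at hL
    refine squeeze_zero (fun _ => norm_nonneg _) (fun k => ?_) hL
    -- the squares of two functions bounded by `1` differ by at most twice their difference
    set b := condMean ζ fun x => f (x + u k • v)
    set c := condMean ζ f
    have hb : Measurable b := measurable_condMean ζ (hfm _)
    have hc : Measurable c := measurable_condMean ζ hf
    have hb1 : ∀ y, |b y| ≤ 1 := abs_condMean_le ζ fun x => hf1 _
    have hc1 : ∀ y, |c y| ≤ 1 := abs_condMean_le ζ hf1
    have hsq : ∀ {r : ℝ}, |r| ≤ 1 → |r ^ 2| ≤ 1 := fun {r} hr => by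
      rw [abs_pow]; exact pow_le_one₀ (abs_nonneg _) hr
    have hdm : Measurable fun x => |f (x + u k • v) - f x| := ((hfm _).sub hf).abs
    have hd2 : ∀ x, |(|f (x + u k • v) - f x|)| ≤ 2 := fun x => by
      rw [abs_abs]
      exact (abs_sub _ _).trans (by linarith [hf1 (x + u k • v), hf1 x])
    have hbc : ∀ y, |b y - c y| ≤ condMean ζ (fun x => |f (x + u k • v) - f x|) y := fun y => by
      have h1 : Integrable (fun x => f (x + u k • v)) (ζ.condKernel y) :=
        integrable_of_abs_le (hfm _) fun x => hf1 _
      have h2 : Integrable f (ζ.condKernel y) := integrable_of_abs_le hf hf1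
      simp only [b, c, condMean]
      rw [← integral_sub h1 h2]
      exact abs_integral_le_integral_abs
    have hib : Integrable (fun y => b y ^ 2) ζ.fst :=
      integrable_of_abs_le (hb.pow_const 2) fun y => hsq (hb1 y)
    have hic : Integrable (fun y => c y ^ 2) ζ.fst :=
      integrable_of_abs_le (hc.pow_const 2) fun y => hsq (hc1 y)
    have hid : Integrable (condMean ζ fun x => |f (x + u k • v) - f x|) ζ.fst :=
      integrable_of_abs_le (measurable_condMean ζ hdm) (abs_condMean_le ζ hd2)
    calc ‖a (u k) - a 0‖ = |∫ y, (b y ^ 2 - c y ^ 2) ∂ζ.fst| := by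
          rw [integral_sub hib hic]; simp [a, b, c]
      _ ≤ ∫ y, |b y ^ 2 - c y ^ 2| ∂ζ.fst := abs_integral_le_integral_abs
      _ ≤ ∫ y, 2 * condMean ζ (fun x => |f (x + u k • v) - f x|) y ∂ζ.fst := by
          refine integral_mono (hib.sub hic).abs (hid.const_mul 2) fun y => ?_
          change |b y ^ 2 - c y ^ 2| ≤ _
          rw [sq_sub_sq, abs_mul]
          refine mul_le_mul ?_ (hbc y) (abs_nonneg _) zero_le_two
          exact (abs_add_le _ _).trans (by linarith [hb1 y, hc1 y])
      _ = 2 * ∫ x, |f (x + u k • v) - f x| ∂ζ.snd := by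
          have := integral_mul_condMean ζ hdm hd2 (h := fun _ => 1) measurable_const (D := 1)
            fun _ => by simp
          simp only [one_mul] at this
          rw [integral_const_mul, ← this, Measure.snd,
            integral_map measurable_snd.aemeasurable hdm.aestronglyMeasurable]
  have h1 : a 1 ≤ a 0 := ge_of_tendsto' hlim fun k => hmono (hu1 k)
  have h0 : ∫ y, (condMean ζ (fun x => f (x + v)) y - condMean ζ f (S y)) ^ 2 ∂ζ.fst = 0 := by
    refine le_antisymm ?_ (integral_nonneg fun y => sq_nonneg _)
    rw [integral_sq_condMean_comp_sub ζ hS hR hζ hf hf1]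
    simpa [a] using h1
  have hi : Integrable (fun y => (condMean ζ (fun x => f (x + v)) y - condMean ζ f (S y)) ^ 2)
      ζ.fst := by
    refine integrable_of_abs_le (C := 2 ^ 2) (((measurable_condMean ζ (hf.comp hR)).sub
      ((measurable_condMean ζ hf).comp hS)).pow_const 2) fun y => ?_
    rw [abs_pow]
    have h3 := abs_condMean_le ζ (f := fun x => f (x + v)) (C := 1) (fun x => hf1 _) y
    have h4 := abs_condMean_le ζ hf1 (S y)
    exact pow_le_pow_left₀ (abs_nonneg _) ((abs_sub _ _).trans (by linarith)) 2
  exact ((integral_eq_zero_iff_of_nonneg (fun y => sq_nonneg _) hi).1 h0).mono fun y hy =>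
    sub_eq_zero.1 (pow_eq_zero_iff two_ne_zero |>.1 hy)

/-- The disintegration over the first coordinate is equivariant. -/
theorem condKernel_translate {t : Set E} (ht : MeasurableSet t) :
    ∀ᵐ y ∂ζ.fst, ζ.condKernel y ((fun x => x + v) ⁻¹' t) = ζ.condKernel (S y) t := by
  have hR : Measurable fun x : E => x + v := by fun_prop
  have h := condMean_translate ζ hS hζ hu1 hu (f := t.indicator 1)
    (measurable_one.indicator ht) fun x => by
      by_cases hx : x ∈ t <;> simp [hx]
  filter_upwards [h] with y hy
  have e : (fun x : E => t.indicator (1 : E → ℝ) (x + v)) =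
      ((fun x => x + v) ⁻¹' t).indicator 1 := rfl
  rw [condMean, condMean, e, integral_indicator_one (hR ht), integral_indicator_one ht] at hy
  exact (measureReal_eq_measureReal_iff).1 hy

theorem measurePreserving_selfJoining : MeasurePreserving
    (Prod.map S (Prod.map (fun x => x + v) fun x => x + v)) (selfJoining ζ) (selfJoining ζ) := by
  have hR : Measurable fun x : E => x + v := by fun_prop
  have hSp := measurePreserving_fst_of_prodMap ζ hS hζ
  have hm : Measurable (Prod.map S (Prod.map (fun x : E => x + v) fun x => x + v)) :=
    hS.prodMap (hR.prodMap hR)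
  refine ⟨hm, ?_⟩
  have : IsProbabilityMeasure ((selfJoining ζ).map
    (Prod.map S (Prod.map (fun x => x + v) fun x => x + v))) :=
    Measure.isProbabilityMeasure_map hm.aemeasurable
  refine Measure.ext_prod₃ fun {s t w} hs ht hw => ?_
  rw [Measure.map_apply hm (hs.prod (ht.prod hw)),
    show Prod.map S (Prod.map (fun x : E => x + v) fun x => x + v) ⁻¹' s ×ˢ t ×ˢ w =
      (S ⁻¹' s) ×ˢ ((fun x => x + v) ⁻¹' t) ×ˢ ((fun x => x + v) ⁻¹' w) from rfl,
    selfJoining_apply ζ (hS hs) (hR ht) (hR hw),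
    selfJoining_apply ζ hs ht hw]
  have hk : Measurable fun y => ζ.condKernel y t * ζ.condKernel y w :=
    (Kernel.measurable_coe ζ.condKernel ht).mul (Kernel.measurable_coe ζ.condKernel hw)
  rw [← hSp.setLIntegral_comp_preimage hs hk]
  refine lintegral_congr_ae (ae_restrict_of_ae ?_)
  filter_upwards [condKernel_translate ζ hS hζ hu1 hu ht,
    condKernel_translate ζ hS hζ hu1 hu hw] with y h1 h2
  rw [h1, h2]

/-- Two invariant functions of the two copies in the self-joining are independent if the system in
the first coordinate is ergodic. -/
theorem selfJoining_prod_of_invariant (hSe : Ergodic S ζ.fst) {t w : Set E}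
    (ht : MeasurableSet t) (hw : MeasurableSet w) (htv : (fun x => x + v) ⁻¹' t = t) :
    selfJoining ζ (Set.univ ×ˢ t ×ˢ w) = ζ.snd t * ζ.snd w := by
  have h := condKernel_translate ζ hS hζ hu1 hu ht
  rw [htv] at h
  obtain ⟨c, hc⟩ := hSe.ae_eq_const_of_ae_eq_comp₀
    (Kernel.measurable_coe ζ.condKernel ht).nullMeasurable (h.mono fun y hy => hy.symm)
  have hsnd : ∀ {a : Set E}, MeasurableSet a → ζ.snd a = ∫⁻ y, ζ.condKernel y a ∂ζ.fst := by
    intro a ha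
    rw [← setLIntegral_univ, setLIntegral_condKernel ζ .univ ha, Measure.snd_apply ha,
      Set.univ_prod]
  have hct : ζ.snd t = c := by
    rw [hsnd ht, lintegral_congr_ae hc]
    simp
  rw [selfJoining_apply ζ .univ ht hw, setLIntegral_univ, hct, hsnd hw,
    ← lintegral_const_mul _ (Kernel.measurable_coe ζ.condKernel hw)]
  refine lintegral_congr_ae (hc.mono fun y hy => ?_)
  simp only [Function.const] at hy
  simp only [hy]

end Rigid

/-! ### Transfer functions of the product of two cocycles -/

/-- The translation vector of the skew product without its last coordinate. -/
noncomputable def stepVec (α : ℝ) : UnitAddCircle × UnitAddCircle := (0, (α : UnitAddCircle))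

theorem cocycleProd_succ (α : ℝ) (n : ℕ) (t s : UnitAddCircle) : cocycleProd α (n + 1) t s =
    cocycleProd α n t s * ((cocycle t (s + n • (α : UnitAddCircle)) : ℤ) : ℝ) := by
  rw [cocycleProd, Finset.prod_range_succ, coe_nsmul_mul]; rfl

theorem integral_cocycleProd_add (α : ℝ) (n : ℕ) (t s : UnitAddCircle) :
    ∫ w, cocycleProd α n t (s + w) = cocycleMean α n t :=
  integral_add_left_eq_self (fun s => cocycleProd α n t s) s

theorem exists_subseq_tendsto_ae_zero {Ω : Type*} [MeasurableSpace Ω] {P : Measure Ω}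
    {f : ℕ → Ω → ℝ} (hf : ∀ k, Integrable (f k) P)
    (h : Tendsto (fun k => ∫ ω, |f k ω| ∂P) atTop (𝓝 0)) :
    ∃ ns : ℕ → ℕ, StrictMono ns ∧ ∀ᵐ ω ∂P, Tendsto (fun i => f (ns i) ω) atTop (𝓝 0) := by
  have hL : Tendsto (fun k => eLpNorm (f k - fun _ => (0 : ℝ)) 1 P) atTop (𝓝 0) := by
    have h1 := ENNReal.tendsto_ofReal h
    rw [ENNReal.ofReal_zero] at h1
    refine h1.congr fun k => ?_
    rw [eLpNorm_one_eq_lintegral_enorm, show (fun _ : Ω => (0 : ℝ)) = 0 from rfl, sub_zero]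
    exact ofReal_integral_norm_eq_lintegral_enorm (hf k)
  exact (tendstoInMeasure_of_tendsto_eLpNorm one_ne_zero
    (fun k => (hf k).aestronglyMeasurable) aestronglyMeasurable_const hL).exists_seq_tendsto_ae

section Core

variable {α : ℝ} (hα : Irrational α) {q : ℕ → ℕ} {p : ℕ → ℤ} (hq : ∀ k, k + 1 < q k)
  (hpq : ∀ k, IsCoprime (p k) (q k : ℤ)) (hqp : ∀ k, |q k * α - p k| < 1 / q k)

include hq hqp

theorem tendsto_abs_mul_sub : Tendsto (fun k => |q k * α - p k|) atTop (𝓝 0) := by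
  refine squeeze_zero (fun _ => abs_nonneg _) (fun k => ?_)
    (tendsto_one_div_add_atTop_nhds_zero_nat (𝕜 := ℝ))
  refine (hqp k).le.trans (one_div_le_one_div_of_le (by positivity) ?_)
  exact_mod_cast (hq k).le

theorem tendsto_nsmul_coe : Tendsto (fun k => q k • (α : UnitAddCircle)) atTop (𝓝 0) := by
  rw [tendsto_zero_iff_norm_tendsto_zero]
  refine squeeze_zero (fun _ => norm_nonneg _) (fun k => ?_) (tendsto_abs_mul_sub hq hqp)
  rw [← coe_nsmul_mul, UnitAddCircle.norm_eq]
  exact round_le _ _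

theorem tendsto_nsmul_stepVec : Tendsto (fun k => q k • stepVec α) atTop (𝓝 0) := by
  have h := (tendsto_const_nhds (x := (0 : UnitAddCircle))).prodMk_nhds (tendsto_nsmul_coe hq hqp)
  have h0 : ∀ k, q k • stepVec α = (0, q k • (α : UnitAddCircle)) := fun k => by simp [stepVec]
  simp only [h0]
  exact h

include hα hpq

/-- The means `|cocycleMean α q t|` and `|cocycleMean α q t'|` along the denominators of good
approximations are not asymptotically equal, except on a null set of pairs `(t, t')`. -/
theorem measure_tendsto_abs_cocycleMean_sub_eq_zero :
    ((volume : Measure UnitAddCircle).prod (volume : Measure UnitAddCircle))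
      {x | Tendsto (fun k => |cocycleMean α (q k) x.2| - |cocycleMean α (q k) x.1|)
        atTop (𝓝 0)} = 0 := by
  have hw : ∀ k, Measurable fun t => |cocycleMean α (q k) t| := fun k =>
    (measurable_cocycleMean α (q k)).abs
  have hCm : MeasurableSet {x : UnitAddCircle × UnitAddCircle |
      Tendsto (fun k => |cocycleMean α (q k) x.2| - |cocycleMean α (q k) x.1|) atTop (𝓝 0)} :=
    measurableSet_tendsto _ fun k => ((hw k).comp measurable_snd).sub ((hw k).comp measurable_fst)
  rw [Measure.measure_prod_null hCm]
  refine ae_of_all _ fun t₀ => ?_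
  by_contra hne
  -- the section at `t₀` is invariant under the rotation, hence of full measure
  have hinv : rotation α ⁻¹' (Prod.mk t₀ ⁻¹' {x : UnitAddCircle × UnitAddCircle |
      Tendsto (fun k => |cocycleMean α (q k) x.2| - |cocycleMean α (q k) x.1|) atTop (𝓝 0)}) =
      Prod.mk t₀ ⁻¹' {x : UnitAddCircle × UnitAddCircle |
      Tendsto (fun k => |cocycleMean α (q k) x.2| - |cocycleMean α (q k) x.1|) atTop (𝓝 0)} := by
    ext t
    have hd : Tendsto (fun k => |cocycleMean α (q k) (rotation α t)| - |cocycleMean α (q k) t|)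
        atTop (𝓝 0) := by
      rw [tendsto_zero_iff_abs_tendsto_zero]
      refine squeeze_zero (fun _ => abs_nonneg _)
        (fun k => abs_abs_cocycleMean_rotation_sub_le α (q k) t (p k)) ?_
      simpa using (tendsto_abs_mul_sub hq hqp).const_mul 2
    simp only [Set.mem_preimage, Set.mem_ofPred_eq]
    constructor
    · intro h
      have := h.sub hd
      simpa using this
    · intro h
      have := h.add hd
      simpa using this
  have hae : ∀ᵐ t, Tendsto (fun k => |cocycleMean α (q k) t| - |cocycleMean α (q k) t₀|)
      atTop (𝓝 0) := by
    rcases (ergodic_rotation hα).toPreErgodic.ae_mem_or_ae_notMem (measurable_prodMk_left hCm) hinv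
      with h | h
    · exact h
    · exact absurd (measure_eq_zero_iff_ae_notMem.2 h) hne
  have hlim := tendsto_integral_of_dominated_convergence (μ := (volume : Measure UnitAddCircle))
    (F := fun k t => |(|cocycleMean α (q k) t| - |cocycleMean α (q k) t₀|)|) (f := fun _ => (0 : ℝ))
    (fun _ => (2 : ℝ))
    (fun k => ((hw k).sub_const _).abs.aestronglyMeasurable) (integrable_const _)
    (fun k => ae_of_all _ fun t => by
      rw [Real.norm_eq_abs, abs_abs]
      refine (abs_sub _ _).trans ?_
      rw [abs_abs, abs_abs]
      linarith [abs_cocycleMean_le_one α (q k) t, abs_cocycleMean_le_one α (q k) t₀])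
    (hae.mono fun t ht => by simpa using ht.abs)
  have h2 : ∀ k, 2 ≤ q k := fun k => by have := hq k; omega
  have := ge_of_tendsto' hlim fun k =>
    integral_abs_cocycleMean_sub_ge (h2 k) (hpq k) (hqp k) (|cocycleMean α (q k) t₀|)
  norm_num at this

variable {P : Measure ((UnitAddCircle × UnitAddCircle) × UnitAddCircle × UnitAddCircle)}
  [IsProbabilityMeasure P]
  (hP : MeasurePreserving (fun x => x + (stepVec α, stepVec α)) P P)
  {F : (UnitAddCircle × UnitAddCircle) × UnitAddCircle × UnitAddCircle → ℝ}
  (hF : Measurable F) (hF1 : ∀ x, |F x| ≤ 1)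
  (hFc : ∀ᵐ x ∂P, F (x + (stepVec α, stepVec α)) =
    ((cocycle x.1.1 x.1.2 : ℤ) : ℝ) * ((cocycle x.2.1 x.2.2 : ℤ) : ℝ) * F x)

omit hα hq hpq hqp [IsProbabilityMeasure P] in
include hP hFc in
/-- The transformation rule of `F`, iterated. -/
theorem ae_eq_cocycleProd_mul (n : ℕ) : ∀ᵐ x ∂P, F (x + n • (stepVec α, stepVec α)) =
    cocycleProd α n x.1.1 x.1.2 * cocycleProd α n x.2.1 x.2.2 * F x := by
  induction n with
  | zero => exact ae_of_all _ fun x => by simp [cocycleProd]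
  | succ n ih =>
    filter_upwards [ih, (measurePreserving_add_nsmul hP n).quasiMeasurePreserving.ae hFc]
      with x h1 h2
    rw [succ_nsmul, ← add_assoc, h2, h1, cocycleProd_succ, cocycleProd_succ]
    simp only [Prod.fst_add, Prod.snd_add, Prod.smul_fst, Prod.smul_snd, stepVec, nsmul_zero,
      add_zero]
    ring

omit hq hpq hqp in
/-- Averaging over the diagonal flow, which preserves every finite measure preserved by the
diagonal rotation. -/
theorem integral_abs_cocycleMean_sub_le {Q : Measure ((UnitAddCircle × UnitAddCircle) ×
    UnitAddCircle × UnitAddCircle)} [IsFiniteMeasure Q]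
    (hQ : MeasurePreserving (fun x => x + (stepVec α, stepVec α)) Q Q) (n : ℕ) :
    ∫ x, |cocycleMean α n x.1.1 - cocycleMean α n x.2.1| ∂Q ≤
      ∫ x, |cocycleProd α n x.1.1 x.1.2 - cocycleProd α n x.2.1 x.2.2| ∂Q := by
  let f : ((UnitAddCircle × UnitAddCircle) × UnitAddCircle × UnitAddCircle) → ℝ := fun x =>
    cocycleProd α n x.1.1 x.1.2 - cocycleProd α n x.2.1 x.2.2
  let j : UnitAddCircle → (UnitAddCircle × UnitAddCircle) × UnitAddCircle × UnitAddCircle :=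
    fun w => ((0, w), (0, w))
  have hf : Measurable f := ((measurable_cocycleProd α n).comp measurable_fst).sub
    ((measurable_cocycleProd α n).comp measurable_snd)
  have hf2 : ∀ x, |f x| ≤ 2 := fun x => (abs_sub _ _).trans (by
    rw [abs_cocycleProd, abs_cocycleProd]; norm_num)
  have hj : Continuous j := by fun_prop
  have hmp : ∀ w, MeasurePreserving (fun x => x + j w) Q Q := fun w => by
    refine measurePreserving_add_of_mem_closure hQ ?_
    refine map_mem_closure hj (denseRange_nsmul hα w) ?_
    rintro _ ⟨m, rfl⟩
    exact ⟨m, by simp [j, stepVec, Prod.smul_mk]⟩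
  have hfe : ∀ x w, f (x + j w) = cocycleProd α n x.1.1 (x.1.2 + w) -
      cocycleProd α n x.2.1 (x.2.2 + w) := fun x w => by simp [f, j]
  have hfj : Measurable fun z : ((UnitAddCircle × UnitAddCircle) × UnitAddCircle × UnitAddCircle) ×
      UnitAddCircle => f (z.1 + j z.2) := by
    simp only [hfe]
    exact ((measurable_cocycleProd α n).comp (f := fun z : ((UnitAddCircle × UnitAddCircle) ×
      UnitAddCircle × UnitAddCircle) × UnitAddCircle => (z.1.1.1, z.1.1.2 + z.2)) (by fun_prop)).sub
      ((measurable_cocycleProd α n).comp (f := fun z : ((UnitAddCircle × UnitAddCircle) ×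
      UnitAddCircle × UnitAddCircle) × UnitAddCircle => (z.1.2.1, z.1.2.2 + z.2)) (by fun_prop))
  have hi : Integrable (fun z : ((UnitAddCircle × UnitAddCircle) × UnitAddCircle × UnitAddCircle) ×
      UnitAddCircle => |f (z.1 + j z.2)|) (Q.prod volume) :=
    integrable_of_abs_le (C := 2) hfj.abs fun z => by rw [abs_abs]; exact hf2 _
  have hcm : ∀ t s, Measurable fun w => cocycleProd α n t (s + w) := fun t s =>
    (measurable_cocycleProd α n).comp (f := fun w => (t, s + w)) (by fun_prop)
  have hmean : ∀ x : (UnitAddCircle × UnitAddCircle) × UnitAddCircle × UnitAddCircle,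
      cocycleMean α n x.1.1 - cocycleMean α n x.2.1 = ∫ w, f (x + j w) := fun x => by
    have hc : ∀ t s, Integrable (fun w => cocycleProd α n t (s + w)) volume := fun t s =>
      integrable_of_abs_le (C := 1) (hcm t s) fun w => (abs_cocycleProd _ _ _ _).le
    rw [← integral_cocycleProd_add α n x.1.1 x.1.2, ← integral_cocycleProd_add α n x.2.1 x.2.2,
      ← integral_sub (hc _ _) (hc _ _)]
    simp only [hfe]
  calc ∫ x, |cocycleMean α n x.1.1 - cocycleMean α n x.2.1| ∂Q
      ≤ ∫ x, (∫ w, |f (x + j w)|) ∂Q := by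
        refine integral_mono_of_nonneg (ae_of_all _ fun x => abs_nonneg _) hi.integral_prod_left
          (ae_of_all _ fun x => ?_)
        change |cocycleMean α n x.1.1 - cocycleMean α n x.2.1| ≤ _
        rw [hmean]
        exact abs_integral_le_integral_abs
    _ = ∫ w : UnitAddCircle, ∫ x, |f (x + j w)| ∂Q :=
        integral_integral_swap (f := fun x w => |f (x + j w)|) hi
    _ = ∫ w : UnitAddCircle, ∫ x, |f x| ∂Q := by
        refine integral_congr_ae (ae_of_all _ fun w => ?_)
        exact integral_comp_of_measurePreserving (hmp w) hf.abs
    _ = ∫ x, |f x| ∂Q := by simp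

include hP hF hF1 hFc in
/-- For two independent parameters `t, t'`, the product of the cocycles of `t` and `t'` over a
pair of rotation orbits admits no nonzero transfer function. -/
theorem ae_eq_zero_of_equivariant
    (hind : P.map (fun x => (x.1.1, x.2.1)) = (volume : Measure UnitAddCircle).prod volume) :
    ∀ᵐ x ∂P, F x = 0 := by
  -- `|F|` is invariant, so it is the density of a finite invariant measure `Q`
  set d : (UnitAddCircle × UnitAddCircle) × UnitAddCircle × UnitAddCircle → NNReal :=
    fun x => ‖F x‖₊ with hd
  have hdm : Measurable d := hF.nnnorm
  set Q := P.withDensity fun x => (d x : ENNReal) with hQdef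
  have hQfin : IsFiniteMeasure Q := by
    refine isFiniteMeasure_withDensity (ne_of_lt ?_)
    calc ∫⁻ x, (d x : ENNReal) ∂P ≤ ∫⁻ _, 1 ∂P := lintegral_mono fun x => by
          exact ENNReal.coe_le_one_iff.2 (NNReal.coe_le_coe.1 (hF1 x))
      _ < ⊤ := by simp
  have hQint : ∀ f : (UnitAddCircle × UnitAddCircle) × UnitAddCircle × UnitAddCircle → ℝ,
      ∫ x, f x ∂Q = ∫ x, |F x| * f x ∂P := fun f => by
    rw [hQdef, integral_withDensity_eq_integral_smul hdm]
    rfl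
  have hQinv : MeasurePreserving (fun x => x + (stepVec α, stepVec α)) Q Q := by
    refine ⟨by fun_prop, ?_⟩
    ext s hs
    rw [Measure.map_apply (by fun_prop) hs, withDensity_apply _ hs,
      withDensity_apply _ (hP.measurable hs),
      ← hP.setLIntegral_comp_preimage hs (by fun_prop)]
    refine lintegral_congr_ae (ae_restrict_of_ae (hFc.mono fun x hx => ?_))
    have : d (x + (stepVec α, stepVec α)) = d x := by
      rw [← NNReal.coe_inj]
      change |F (x + (stepVec α, stepVec α))| = |F x|
      rw [hx, abs_mul, abs_mul, abs_units_coe, abs_units_coe, one_mul, one_mul]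
    simp only [this]
  -- the products of the two cocycles along the times `q k` agree asymptotically where `F ≠ 0`, as
  -- `F` changes little under the translation by `q k • (stepVec α, stepVec α)`
  have hlim1 : Tendsto (fun k => ∫ x, |cocycleProd α (q k) x.1.1 x.1.2 -
      cocycleProd α (q k) x.2.1 x.2.2| ∂Q) atTop (𝓝 0) := by
    have hu : Tendsto (fun k => q k • (stepVec α, stepVec α)) atTop (𝓝 0) := by
      have h := tendsto_nsmul_stepVec hq hqp
      have h0 : ∀ k, q k • (stepVec α, stepVec α) = (q k • stepVec α, q k • stepVec α) :=
        fun k => rfl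
      simp only [h0]
      exact h.prodMk_nhds h
    refine (tendsto_integral_abs_translate_sub hP hu (integrable_of_abs_le hF hF1)).congr
      fun k => ?_
    rw [hQint]
    refine integral_congr_ae ((ae_eq_cocycleProd_mul hP hFc (q k)).mono fun x hx => ?_)
    simp only [hx]
    set a := cocycleProd α (q k) x.1.1 x.1.2
    have hb2 : cocycleProd α (q k) x.2.1 x.2.2 * cocycleProd α (q k) x.2.1 x.2.2 = 1 := by
      rw [← abs_mul_abs_self, abs_cocycleProd, one_mul]
    have hb1 := abs_cocycleProd α (q k) x.2.1 x.2.2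
    set b := cocycleProd α (q k) x.2.1 x.2.2
    rw [show a * b * F x - F x = b * (F x * (a - b)) by linear_combination F x * hb2, abs_mul, hb1,
      one_mul, abs_mul]
  have hlim2 : Tendsto (fun k => ∫ x, |cocycleMean α (q k) x.1.1 -
      cocycleMean α (q k) x.2.1| ∂Q) atTop (𝓝 0) :=
    squeeze_zero (fun _ => integral_nonneg fun _ => abs_nonneg _)
      (fun k => integral_abs_cocycleMean_sub_le hα hQinv (q k)) hlim1
  have hmm : ∀ k, Measurable fun x : (UnitAddCircle × UnitAddCircle) × UnitAddCircle ×
      UnitAddCircle => cocycleMean α (q k) x.1.1 - cocycleMean α (q k) x.2.1 := fun k =>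
    ((measurable_cocycleMean α (q k)).comp measurable_fst.fst).sub
      ((measurable_cocycleMean α (q k)).comp measurable_snd.fst)
  obtain ⟨ns, hns, hae⟩ := exists_subseq_tendsto_ae_zero (P := Q) (fun k =>
    integrable_of_abs_le (C := 2) (hmm k) fun x => (abs_sub _ _).trans (by
      linarith [abs_cocycleMean_le_one α (q k) x.1.1, abs_cocycleMean_le_one α (q k) x.2.1])) hlim2
  have hq' : ∀ k, k + 1 < q (ns k) := fun k =>
    (Nat.add_le_add_right (hns.id_le k) 1).trans_lt (hq (ns k))
  have hnull := measure_tendsto_abs_cocycleMean_sub_eq_zero hα hq' (fun k => hpq (ns k))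
    fun k => hqp (ns k)
  rw [← hind] at hnull
  have hnull' : ∀ᵐ x ∂P, ¬ Tendsto (fun k => |cocycleMean α (q (ns k)) x.2.1| -
      |cocycleMean α (q (ns k)) x.1.1|) atTop (𝓝 0) :=
    ae_of_ae_map (f := fun x : (UnitAddCircle × UnitAddCircle) × UnitAddCircle × UnitAddCircle =>
      (x.1.1, x.2.1)) (by fun_prop) (measure_eq_zero_iff_ae_notMem.1 hnull)
  rw [hQdef, ae_withDensity_iff (by fun_prop)] at hae
  filter_upwards [hae, hnull'] with x h1 h2
  by_contra hx
  refine h2 ?_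
  have h3 := h1 (by simpa [hd] using hx)
  rw [tendsto_zero_iff_abs_tendsto_zero] at h3 ⊢
  refine squeeze_zero (fun _ => abs_nonneg _) (fun k => ?_) h3
  rw [Function.comp, Function.comp, abs_sub_comm (cocycleMean α (q (ns k)) x.1.1)]
  exact abs_abs_sub_abs_le _ _

end Core

/-! ### Absence of correlation -/

/-- In every joining of the skew product with an ergodic system, the last coordinate of the skew
product is uncorrelated to the ergodic system. -/
theorem IsJoining.integral_sign_mul_eq_zero {α : ℝ} (hα : Irrational α) {Y : Type*}
    [MeasurableSpace Y] {S : Y → Y} {ν : Measure Y} (hS : Ergodic S ν)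
    {ξ : Measure ((UnitAddCircle × UnitAddCircle × ℤˣ) × Y)}
    (hξ : IsJoining (skew α) skewMeasure S ν ξ) {g : Y → ℝ} (hg : Measurable g) {C : ℝ}
    (hC : ∀ y, |g y| ≤ C) : ∫ w, ((w.1.2.2 : ℤ) : ℝ) * g w.2 ∂ξ = 0 := by
  have : IsProbabilityMeasure ξ := by
    have h : IsProbabilityMeasure (ξ.map Prod.fst) := by rw [hξ.map_fst]; infer_instance
    exact Measure.isProbabilityMeasure_of_map (Prod.fst)
  choose q p hq hpq hqp using fun k : ℕ => exists_good_approximation hα (k + 1)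
  -- the conditional mean `K` of the sign given `y` and `(t, s)`
  let Z : (UnitAddCircle × UnitAddCircle × ℤˣ) × Y → Y × UnitAddCircle × UnitAddCircle :=
    fun w => (w.2, w.1.1, w.1.2.1)
  have hZ : Measurable Z := by fun_prop
  let f : (UnitAddCircle × UnitAddCircle × ℤˣ) × Y → ℝ := fun w => ((w.1.2.2 : ℤ) : ℝ)
  have hf : Measurable f := measurable_units_coe.comp (by fun_prop)
  obtain ⟨K, hKm, hK1, hK⟩ := exists_conditional_mean ξ hZ hf fun w => (abs_units_coe _).le
  set ζ := ξ.map Z with hζdef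
  have : IsProbabilityMeasure ζ := Measure.isProbabilityMeasure_map hZ.aemeasurable
  set R : Y × UnitAddCircle × UnitAddCircle → Y × UnitAddCircle × UnitAddCircle :=
    Prod.map S fun x => x + stepVec α with hR
  have hRm : Measurable R := hS.measurable.prodMap (by fun_prop)
  have hRZ : ∀ w, Z (Prod.map (skew α) S w) = R (Z w) := fun w => by
    simp [Z, hR, skew, rotation, stepVec]
  have hζ : MeasurePreserving R ζ ζ := by
    refine ⟨hRm, ?_⟩
    have hc : R ∘ Z = Z ∘ Prod.map (skew α) S := funext fun w => (hRZ w).symm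
    rw [hζdef, Measure.map_map hRm hZ, hc, ← Measure.map_map hZ hξ.invariant.measurable,
      hξ.invariant.map_eq]
  have hζ1 : ζ.fst = ν := by
    rw [hζdef, Measure.fst, Measure.map_map measurable_fst hZ]
    exact hξ.map_snd
  have hζ2 : ζ.snd = (volume : Measure UnitAddCircle).prod volume := by
    have h1 : MeasurePreserving (fun x : UnitAddCircle × UnitAddCircle × ℤˣ => (x.1, x.2.1))
        skewMeasure ((volume : Measure UnitAddCircle).prod volume) :=
      (MeasurePreserving.id _).prod measurePreserving_fst
    rw [hζdef, Measure.snd, Measure.map_map measurable_snd hZ, ← h1.map_eq, ← hξ.map_fst,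
      Measure.map_map h1.measurable measurable_fst]
    rfl
  have hKR : ∀ᵐ z ∂ζ, K (R z) = ((cocycle z.2.1 z.2.2 : ℤ) : ℝ) * K z := by
    refine conditional_mean_equivariant hZ hKm hK1 hK hf hξ.invariant hζ hRZ
      (c := fun z => ((cocycle z.2.1 z.2.2 : ℤ) : ℝ))
      (measurable_units_coe.comp (measurable_cocycle.comp measurable_snd))
      (fun z => abs_units_coe _) (ae_of_all _ fun w => ?_)
    simp [f, Z, skew]
  -- the product of two copies of `K` in the self-joining, and its conditional mean `F`
  have hq1 : ∀ k, 1 ≤ q k := fun k => by have := hq k; omega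
  have hqv := tendsto_nsmul_stepVec hq hqp
  set W := selfJoining ζ
  have hW : MeasurePreserving _ W W := measurePreserving_selfJoining ζ hS.measurable hζ hq1 hqv
  let f₂ : Y × (UnitAddCircle × UnitAddCircle) × UnitAddCircle × UnitAddCircle → ℝ := fun x =>
    K (x.1, x.2.1) * K (x.1, x.2.2)
  have hf₂ : Measurable f₂ := by fun_prop
  obtain ⟨F, hFm, hF1, hF⟩ := exists_conditional_mean W measurable_snd hf₂ fun x => by
    rw [abs_mul]; exact mul_le_one₀ (hK1 _) (abs_nonneg _) (hK1 _)
  have hWp : IsProbabilityMeasure (W.map Prod.snd) :=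
    Measure.isProbabilityMeasure_map measurable_snd.aemeasurable
  have hP : MeasurePreserving (fun x => x + (stepVec α, stepVec α)) (W.map Prod.snd)
      (W.map Prod.snd) := by
    refine ⟨by fun_prop, ?_⟩
    conv_rhs => rw [← hW.map_eq]
    rw [Measure.map_map (by fun_prop) measurable_snd, Measure.map_map measurable_snd hW.measurable]
    rfl
  have hFc : ∀ᵐ x ∂W.map Prod.snd, F (x + (stepVec α, stepVec α)) =
      ((cocycle x.1.1 x.1.2 : ℤ) : ℝ) * ((cocycle x.2.1 x.2.2 : ℤ) : ℝ) * F x := by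
    refine conditional_mean_equivariant measurable_snd hFm hF1 hF hf₂ hW hP (fun w => rfl)
      (c := fun x => ((cocycle x.1.1 x.1.2 : ℤ) : ℝ) * ((cocycle x.2.1 x.2.2 : ℤ) : ℝ))
      ((measurable_units_coe.comp (measurable_cocycle.comp measurable_fst)).mul
        (measurable_units_coe.comp (measurable_cocycle.comp measurable_snd)))
      (fun x => by rw [abs_mul, abs_units_coe, abs_units_coe, one_mul]) ?_
    filter_upwards [(measurePreserving_selfJoining_fst ζ).quasiMeasurePreserving.ae hKR,
      (measurePreserving_selfJoining_snd ζ).quasiMeasurePreserving.ae hKR] with x h1 h2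
    simp only [hR, Prod.map_apply] at h1 h2
    simp only [f₂, Prod.map_fst, Prod.map_snd, h1, h2]
    ring
  have hind : (W.map Prod.snd).map (fun x => (x.1.1, x.2.1)) =
      (volume : Measure UnitAddCircle).prod volume := by
    have hm : Measurable fun x : Y × (UnitAddCircle × UnitAddCircle) × UnitAddCircle ×
      UnitAddCircle => (x.2.1.1, x.2.2.1) := by fun_prop
    rw [Measure.map_map (by fun_prop) measurable_snd]
    change W.map (fun x => (x.2.1.1, x.2.2.1)) = _
    have := Measure.isProbabilityMeasure_map (μ := W) hm.aemeasurable
    refine Measure.ext_prod fun {a b} ha hb => ?_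
    rw [Measure.map_apply hm (ha.prod hb), Measure.prod_prod]
    have hpre : (fun x : Y × (UnitAddCircle × UnitAddCircle) × UnitAddCircle ×
        UnitAddCircle => (x.2.1.1, x.2.2.1)) ⁻¹' a ×ˢ b =
        Set.univ ×ˢ (Prod.fst ⁻¹' a) ×ˢ (Prod.fst ⁻¹' b) := by
      ext; simp
    have hmarg : ∀ {a : Set UnitAddCircle}, MeasurableSet a →
        ζ.snd (Prod.fst ⁻¹' a) = volume a := fun ha => by
      rw [hζ2]; exact measurePreserving_fst.measure_preimage ha.nullMeasurableSet
    rw [hpre, selfJoining_prod_of_invariant ζ hS.measurable hζ hq1 hqv (by rwa [hζ1])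
      (measurable_fst ha) (measurable_fst hb) ?_, hmarg ha, hmarg hb]
    ext x
    simp [stepVec]
  have hF0 := ae_eq_zero_of_equivariant hα (fun k => hq k) hpq hqp hP hFm hF1 hFc hind
  -- the square of the conditional mean of the sign given `y` has integral `∫ f₂ ∂W = ∫ F = 0`
  have hsq : ∫ y, (∫ x, K (y, x) ∂ζ.condKernel y) ^ 2 ∂ζ.fst = 0 := by
    have h1 := hF (fun _ => 1) 1 measurable_const fun _ => by simp
    simp only [mul_one] at h1
    rw [← integral_selfJoining_mul ζ hKm hK1, h1]
    exact integral_eq_zero_of_ae hF0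
  have hGm : Measurable fun y => ∫ x, K (y, x) ∂ζ.condKernel y :=
    hKm.stronglyMeasurable.integral_kernel_prod_right'.measurable
  have hG1 : ∀ y, |∫ x, K (y, x) ∂ζ.condKernel y| ≤ 1 := fun y => by
    refine (norm_integral_le_of_norm_le_const (f := fun x => K (y, x))
      (ae_of_all _ fun x => hK1 _)).trans ?_
    simp
  have hG : ∀ᵐ y ∂ζ.fst, ∫ x, K (y, x) ∂ζ.condKernel y = 0 := by
    have hi : Integrable (fun y => (∫ x, K (y, x) ∂ζ.condKernel y) ^ 2) ζ.fst :=
      integrable_of_abs_le (C := 1) (hGm.pow_const 2) fun y => by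
        rw [abs_pow]; exact pow_le_one₀ (abs_nonneg _) (hG1 y)
    exact ((integral_eq_zero_iff_of_nonneg (fun y => sq_nonneg _) hi).1 hsq).mono fun y hy =>
      (pow_eq_zero_iff two_ne_zero).1 hy
  have hi : Integrable (fun z : Y × UnitAddCircle × UnitAddCircle => K z * g z.1)
      (ζ.fst ⊗ₘ ζ.condKernel) := by
    refine integrable_of_abs_le (C := 1 * C) (hKm.mul (hg.comp measurable_fst)) fun z => ?_
    rw [abs_mul]
    exact mul_le_mul (hK1 _) (hC _) (abs_nonneg _) zero_le_one
  calc ∫ w, ((w.1.2.2 : ℤ) : ℝ) * g w.2 ∂ξ = ∫ z, K z * g z.1 ∂ζ :=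
        hK (fun z => g z.1) C (hg.comp measurable_fst) fun z => hC _
    _ = ∫ z, K z * g z.1 ∂(ζ.fst ⊗ₘ ζ.condKernel) := by rw [ζ.disintegrate ζ.condKernel]
    _ = ∫ y, (∫ x, K (y, x) ∂ζ.condKernel y) * g y ∂ζ.fst := by
        rw [Measure.integral_compProd hi]
        simp only [integral_mul_const]
    _ = 0 := integral_eq_zero_of_ae (hG.mono fun y hy => by simp [hy])

/-- Joinings are mapped to joinings by factor maps. -/
theorem IsJoining.map_factor {X' X Y : Type*} [MeasurableSpace X'] [MeasurableSpace X]
    [MeasurableSpace Y] {T' : X' → X'} {μ' : Measure X'} {T : X → X} {μ : Measure X} {S : Y → Y}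
    {ν : Measure Y} {ξ : Measure (X' × Y)} (hξ : IsJoining T' μ' S ν ξ) {Ψ : X' → X}
    (hΨ : IsFactorMap T' μ' T μ Ψ) (hT : Measurable T) (hS : Measurable S) :
    IsJoining T μ S ν (ξ.map (Prod.map Ψ id)) := by
  have hm := hΨ.measurePreserving.measurable
  have hmm : Measurable (Prod.map Ψ (id : Y → Y)) := hm.prodMap measurable_id
  refine ⟨?_, ?_, hT.prodMap hS, ?_⟩
  · rw [Measure.map_map measurable_fst hmm, ← hΨ.measurePreserving.map_eq, ← hξ.map_fst,
      Measure.map_map hm measurable_fst]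
    rfl
  · rw [Measure.map_map measurable_snd hmm]
    exact hξ.map_snd
  · rw [Measure.map_map (hT.prodMap hS) hmm]
    conv_rhs => rw [← hξ.invariant.map_eq, Measure.map_map hmm hξ.invariant.measurable]
    refine Measure.map_congr ?_
    have h := hΨ.equivariant
    rw [← hξ.map_fst] at h
    filter_upwards [ae_of_ae_map measurable_fst.aemeasurable h] with w hw
    simp [Prod.map, hw]

/-- A joining with the itinerary measure lifts to a joining with the skew product, and the symbol
at time `0` of an itinerary is the last coordinate of the skew product. -/
theorem uncorrelated_symbolicMeasure {α : ℝ} (hα : Irrational α) {L : Set ℂ} (hL : IsCompact L)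
    {ν : Measure (ℕ → L)} (hν : Ergodic (shift (A := L)) ν) :
    Uncorrelated (symbolicMeasure α) ν := by
  obtain ⟨C, hC⟩ := hL.isBounded.exists_norm_le
  obtain ⟨Ψ, hΨm, hΨ⟩ := exists_measurable_leftInverse_itinerary hα
  have hΨf := isFactorMap_leftInverse hΨm hΨ
  refine ENNReal.iSup_eq_zero.2 fun ξ => ENNReal.iSup_eq_zero.2 fun hξ => ?_
  have hξ : IsJoining shift (symbolicMeasure α) shift ν ξ := hξ
  have hJ := hξ.map_factor hΨf (measurable_skew α) measurable_shift
  have hmm : Measurable (Prod.map Ψ (id : (ℕ → L) → ℕ → L)) := hΨm.prodMap measurable_id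
  have hξp : IsProbabilityMeasure ξ := by
    have h : IsProbabilityMeasure (ξ.map Prod.fst) := by rw [hξ.map_fst]; infer_instance
    exact Measure.isProbabilityMeasure_of_map (Prod.fst)
  have hsym : ∀ᵐ w ∂ξ, (w.1 0 : ℂ) = (((Ψ w.1).2.2 : ℤ) : ℝ) := by
    have h := ae_itinerary_leftInverse hΨm hΨ
    rw [← hξ.map_fst] at h
    filter_upwards [ae_of_ae_map measurable_fst.aemeasurable h] with w hw
    rw [← hw]
    simp [itinerary, toSign, hw]
  have hκ : Measurable fun w : (ℕ → signs) × (ℕ → L) => (((Ψ w.1).2.2 : ℤ) : ℝ) :=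
    measurable_units_coe.comp (by fun_prop)
  have key : ∀ {g : (ℕ → L) → ℝ}, Measurable g → (∀ y, |g y| ≤ max C 1) →
      ∫ w, (((Ψ w.1).2.2 : ℤ) : ℝ) * g w.2 ∂ξ = 0 := fun {g} hg hgC => by
    rw [← hJ.integral_sign_mul_eq_zero hα hν hg hgC, integral_map hmm.aemeasurable]
    · rfl
    · exact ((measurable_units_coe.comp (by fun_prop : Measurable fun w :
        (UnitAddCircle × UnitAddCircle × ℤˣ) × (ℕ → L) => w.1.2.2)).mul
        (hg.comp measurable_snd)).aestronglyMeasurable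
  have hmean : ∫ x, (x 0 : ℂ) ∂symbolicMeasure α = 0 := by
    rw [← hξ.map_fst, integral_map measurable_fst.aemeasurable
      measurable_zeroth_symbol.aestronglyMeasurable, integral_congr_ae hsym,
    integral_complex_ofReal]
    have := key (g := fun _ => 1) measurable_const fun _ => by simp
    simp only [mul_one] at this
    rw [this, Complex.ofReal_zero]
  have hy : Measurable fun y : ℕ → L => (y 0 : ℂ) := measurable_zeroth_symbol
  have hre : Measurable fun y : ℕ → L => (y 0 : ℂ).re := Complex.measurable_re.comp hy
  have him : Measurable fun y : ℕ → L => (y 0 : ℂ).im := Complex.measurable_im.comp hy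
  have hreC : ∀ y : ℕ → L, |(y 0 : ℂ).re| ≤ max C 1 := fun y =>
    (Complex.abs_re_le_norm _).trans ((hC _ (y 0).2).trans (le_max_left _ _))
  have himC : ∀ y : ℕ → L, |(y 0 : ℂ).im| ≤ max C 1 := fun y =>
    (Complex.abs_im_le_norm _).trans ((hC _ (y 0).2).trans (le_max_left _ _))
  have hint : ∀ {g : (ℕ → L) → ℝ}, Measurable g → (∀ y, |g y| ≤ max C 1) →
      Integrable (fun w : (ℕ → signs) × (ℕ → L) => (((Ψ w.1).2.2 : ℤ) : ℝ) * g w.2) ξ :=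
    fun {g} hg hgC => integrable_of_abs_le (C := max C 1) (hκ.mul (hg.comp measurable_snd))
      fun w => by rw [abs_mul, abs_units_coe, one_mul]; exact hgC _
  have hprod : ∫ w, (w.1 0 : ℂ) * conj (w.2 0 : ℂ) ∂ξ = 0 := by
    calc ∫ w, (w.1 0 : ℂ) * conj (w.2 0 : ℂ) ∂ξ
        = ∫ w, (((((Ψ w.1).2.2 : ℤ) : ℝ) * (w.2 0 : ℂ).re : ℝ) : ℂ) -
            Complex.I * (((((Ψ w.1).2.2 : ℤ) : ℝ) * (w.2 0 : ℂ).im : ℝ) : ℂ) ∂ξ := by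
          refine integral_congr_ae (hsym.mono fun w hw => ?_)
          simp only [hw]
          apply Complex.ext <;> simp
      _ = 0 := by
          rw [integral_sub (hint hre hreC).ofReal ((hint him himC).ofReal.const_mul _),
            integral_const_mul, integral_complex_ofReal, integral_complex_ofReal, key hre hreC,
            key him himC]
          simp
  rw [hprod, hmean]
  simp

end ShiftCorr

theorem mainTheorem5 (α : ℝ) (hα : Irrational α) :
    -- the skew product preserves the probability measure `dt × ds × dκ` and is, through the
    -- second coordinate, an extension of the rotation by `α`
    IsProbabilityMeasure ShiftCorr.skewMeasure ∧
    MeasurePreserving (ShiftCorr.skew α) ShiftCorr.skewMeasure ShiftCorr.skewMeasure ∧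
    ShiftCorr.IsFactorMap (ShiftCorr.skew α) ShiftCorr.skewMeasure
      (ShiftCorr.rotation α) volume (fun p => p.2.1) ∧
    -- its itineraries represent it by a shift-invariant probability measure on `{-1, 1}^ℕ`
    IsProbabilityMeasure (ShiftCorr.symbolicMeasure α) ∧
    MeasurePreserving (ShiftCorr.shift (A := ShiftCorr.signs))
      (ShiftCorr.symbolicMeasure α) (ShiftCorr.symbolicMeasure α) ∧
    ShiftCorr.IsIsoMap (ShiftCorr.skew α) ShiftCorr.skewMeasure
      ShiftCorr.shift (ShiftCorr.symbolicMeasure α) (ShiftCorr.itinerary α) ∧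
    -- which is uncorrelated to every ergodic measure with bounded complex symbols
    (∀ (L : Set ℂ), IsCompact L → ∀ ν : Measure (ℕ → L), IsProbabilityMeasure ν →
      Ergodic (ShiftCorr.shift (A := L)) ν →
        ShiftCorr.Uncorrelated (ShiftCorr.symbolicMeasure α) ν) ∧
    -- and nevertheless is an extension of the (ergodic) rotation by `α`,
    (∃ π : (ℕ → ShiftCorr.signs) → UnitAddCircle,
      ShiftCorr.IsFactorMap ShiftCorr.shift (ShiftCorr.symbolicMeasure α)
        (ShiftCorr.rotation α) volume π ∧
      ∀ᵐ p ∂ShiftCorr.skewMeasure, π (ShiftCorr.itinerary α p) = p.2.1) ∧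
    Ergodic (ShiftCorr.rotation α) volume ∧
    -- hence not disjoint from that rotation,
    ¬ ShiftCorr.AreDisjoint ShiftCorr.shift (ShiftCorr.symbolicMeasure α)
        (ShiftCorr.rotation α) volume ∧
    -- nor from all ergodic shift-invariant measures
    (∃ ν : Measure (ℕ → ShiftCorr.signs), IsProbabilityMeasure ν ∧
      Ergodic (ShiftCorr.shift (A := ShiftCorr.signs)) ν ∧
      ¬ ShiftCorr.AreDisjoint ShiftCorr.shift (ShiftCorr.symbolicMeasure α)
          ShiftCorr.shift ν) := by
  obtain ⟨Ψ, hΨm, hΨ⟩ := ShiftCorr.exists_measurable_leftInverse_itinerary hα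
  have hΨf := ShiftCorr.isFactorMap_leftInverse hΨm hΨ
  have hπ := (ShiftCorr.isFactorMap_snd_fst α).comp hΨf
  refine ⟨inferInstance, ShiftCorr.measurePreserving_skew α, ShiftCorr.isFactorMap_snd_fst α,
    inferInstance, ShiftCorr.measurePreserving_shift α,
    ⟨ShiftCorr.isFactorMap_itinerary α, Ψ, hΨf, hΨ, ShiftCorr.ae_itinerary_leftInverse hΨm hΨ⟩,
    fun L hL ν _ hν => ShiftCorr.uncorrelated_symbolicMeasure hα hL hν,
    ⟨_, hπ, hΨ.mono fun p hp => ?_⟩, ShiftCorr.ergodic_rotation hα, ?_,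
    volume.map (ShiftCorr.halfCoding α),
    Measure.isProbabilityMeasure_map (ShiftCorr.measurable_halfCoding α).aemeasurable,
    ShiftCorr.ergodic_map_halfCoding hα, ?_⟩
  · simp only [Function.comp, hp]
  · exact hπ.not_areDisjoint (ShiftCorr.measurePreserving_shift α)
      (ShiftCorr.measurePreserving_rotation α).measurable
      (measurable_subtype_coe.comp ShiftCorr.measurable_halfSign)
      (fun s => ShiftCorr.norm_signs _) ShiftCorr.integral_halfSign
  · exact ((ShiftCorr.isFactorMap_halfCoding α).comp hπ).not_areDisjoint
      (ShiftCorr.measurePreserving_shift α) ShiftCorr.measurable_shift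
      ShiftCorr.measurable_zeroth_symbol (fun y => ShiftCorr.norm_signs _)
      (ShiftCorr.integral_map_halfCoding α)
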